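/- Let $\mathcal P$ consist of Minimum Vertex Cover (MVC), Maximum Matching (MaxM), Maximum Independent Set (MaxIS), Minimum Dominating Set (MDS), Minimum Edge Dominating Set (MEDS), Minimum Feedback Vertex Set (MFVS) and Minimum Feedback Edge Set (MFES). Inputs are finite simple graphs, except that for MFES they are finite loopless digraphs and a solution is a set of arcs whose removal leaves no directed cycle. For $P\in\mathcal P$, $k\in\mathbb N$ and $\alpha\ge 1$, an $\alpha$-approximate answer to $k$-$P$ on an input $G$ is: if $G$ has a feasible solution of size at most $k$ (minimization) or at least $k$ (maximization), a feasible solution of size at most $\alpha k$ (respectively at least $k/\alpha$), where every node outputs whether it is in the solution (for edge problems: which of its incident edges are in it, so that both endpoints agree); otherwise, all nodes report that there is no such solution. It is exact if $\alpha=1$. In the LOCAL model the nodes of (the underlying undirected graph of) $G$ have distinct identifiers from $\mathbb N$, each initially knows its own identifier and those of its neighbours (and the direction of its arcs), and in each synchronous round every node sends a message of arbitrary size to each neighbour; local computation is unrestricted. A Monte Carlo algorithm is a probability distribution over deterministic algorithms. We say that it solves $\alpha$-approximate $k$-$P$ on $G$ in $T$ rounds with error probability at most $\delta$, with identifiers from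 $I\subset\mathbb N$, if for every assignment of distinct identifiers from $I$ to the nodes of $G$ the outputs after $T$ rounds are an $\alpha$-approximate answer with probability at least $1-\delta$. **Theorem.** Let $P\in\mathcal P$. 1. There is $\varepsilon_0>0$ such that for every $C>0$ there are $c>0$ and $k_0\in\mathbb N$ with the following property. For all $k\ge k_0$, all $\varepsilon$ with $C/k\le\varepsilon\le\varepsilon_0$, all $\delta<1/2$ and all $N\in\mathbb N$ there is a connected input $G$ of $P$ with $n\ge N$ vertices that has a feasible solution of size at most $k$ (minimization) or at least $k$ (maximization), such that for every set $I\subset\mathbb N$ of exactly $n$ identifiers, every Monte Carlo LOCAL algorithm (even one designed for this $G$, $k$ and $I$) that solves $(1+\varepsilon)$-approximate $k$-$P$ on $G$ in $T$ rounds with error probability at most $\delta$ and identifiers from $I$ satisfies $T\ge c/\varepsilon$. 2. There are $c>0$ and $k_0\in\mathbb N$ such that for all $k\ge k_0$, all $\delta<1/2$ and all $N\in\mathbb N$ there is a connected input $G$ of $P$ with $n\ge N$ vertices that has a feasible solution of size at most $k$ (respectively at least $k$), such that for every set $I\subset\mathbb N$ of exactly $n$ identifiers, every Monte Carlo LOCAL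 algorithm that solves exact $k$-$P$ on $G$ in $T$ rounds with error probability at most $\delta$ and identifiers from $I$ satisfies $T\ge ck$. -/

import Mathlib

namespace ParamLocal

/-- Minimum Vertex Cover, Maximum Matching, Maximum Independent Set, Minimum Dominating Set,
Minimum Edge Dominating Set, Minimum Feedback Vertex Set, Minimum Feedback Edge Set. -/
inductive Problem where
  | MVC | MaxM | MaxIS | MDS | MEDS | MFVS | MFES

/-- What a solution is a set of: vertices, (undirected) edges, or arcs. -/
def Problem.Item (P : Problem) (V : Type) : Type :=
  match P with
  | .MVC | .MaxIS | .MDS | .MFVS => V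
  | .MaxM | .MEDS => Sym2 V
  | .MFES => V × V

/-- `MaxM` and `MaxIS` are maximization problems, all the others are minimization problems. -/
def Problem.IsMax (P : Problem) : Prop :=
  match P with
  | .MaxM | .MaxIS => True
  | .MVC | .MDS | .MEDS | .MFVS | .MFES => False

/-- The legal inputs, as digraphs: loopless digraphs for `MFES`, and simple undirected graphs
(that is, loopless symmetric digraphs) for all the other problems. -/
def Problem.IsInstance {V : Type} (P : Problem) (D : Digraph V) : Prop :=
  (∀ v, ¬ D.Adj v v) ∧
    match P with
    | .MFES => True
    | .MVC | .MaxM | .MaxIS | .MDS | .MEDS | .MFVS => ∀ u v, D.Adj u v → D.Adj v u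

/-- The underlying undirected graph, which is also the communication graph. -/
abbrev commGraph {V : Type} (D : Digraph V) : SimpleGraph V := D.toSimpleGraphInclusive

/-- Feasible solutions. -/
def Problem.Feasible {V : Type} (P : Problem) (D : Digraph V) (S : Set (P.Item V)) : Prop :=
  match P, S with
  | .MVC, (U : Set V) => (commGraph D).IsVertexCover U
  | .MaxIS, (U : Set V) => (commGraph D).IsIndepSet U
  | .MDS, (U : Set V) => ∀ v, v ∈ U ∨ ∃ u ∈ U, (commGraph D).Adj u v
  | .MFVS, (U : Set V) => ((commGraph D).induce Uᶜ).IsAcyclic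
  | .MaxM, (Y : Set (Sym2 V)) => Y ⊆ (commGraph D).edgeSet ∧
      ∀ e ∈ Y, ∀ e' ∈ Y, e ≠ e' → ∀ v, v ∈ e → v ∉ e'
  | .MEDS, (Y : Set (Sym2 V)) => Y ⊆ (commGraph D).edgeSet ∧
      ∀ e ∈ (commGraph D).edgeSet, ∃ e' ∈ Y, ∃ v, v ∈ e ∧ v ∈ e'
  | .MFES, (Y : Set (V × V)) => (∀ a ∈ Y, D.Adj a.1 a.2) ∧
      ∀ v, ¬ Relation.TransGen (fun a b => D.Adj a b ∧ (a, b) ∉ Y) v v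

/-- `S` is a feasible solution of size at most `α * k` (minimization) or at least `k / α`
(maximization). -/
def Problem.IsApproxSolution {V : Type} (P : Problem) (D : Digraph V) (k : ℕ) (α : ℝ)
    (S : Set (P.Item V)) : Prop :=
  P.Feasible D S ∧ (P.IsMax → (k : ℝ) / α ≤ S.ncard) ∧ (¬ P.IsMax → (S.ncard : ℝ) ≤ α * k)

/-- There is a solution of size at most `k` (minimization) or at least `k` (maximization). -/
def Problem.HasSolution {V : Type} (P : Problem) (D : Digraph V) (k : ℕ) : Prop :=
  ∃ S : Set (P.Item V), P.IsApproxSolution D k 1 S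

/-- What a node that does not reject outputs: whether it belongs to the solution (vertex problems),
or the set of its incident edges (arcs) that belong to the solution, an edge (arc) being named by
the identifiers of its endpoints. -/
def Problem.Label (P : Problem) : Type :=
  match P with
  | .MVC | .MaxIS | .MDS | .MFVS => Prop
  | .MaxM | .MEDS => Set (Sym2 ℕ)
  | .MFES => Set (ℕ × ℕ)

/-- What node `v` has to output when the solution is `S` and `ident` gives the identifiers. -/
def Problem.label {V : Type} (P : Problem) (ident : V → ℕ) (S : Set (P.Item V)) (v : V) :
    P.Label :=
  match P, S with
  | .MVC, (U : Set V) => v ∈ U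
  | .MaxIS, (U : Set V) => v ∈ U
  | .MDS, (U : Set V) => v ∈ U
  | .MFVS, (U : Set V) => v ∈ U
  | .MaxM, (Y : Set (Sym2 V)) => {f | ∃ e ∈ Y, v ∈ e ∧ f = e.map ident}
  | .MEDS, (Y : Set (Sym2 V)) => {f | ∃ e ∈ Y, v ∈ e ∧ f = e.map ident}
  | .MFES, (Y : Set (V × V)) =>
      {f | ∃ a ∈ Y, (v = a.1 ∨ v = a.2) ∧ f = (ident a.1, ident a.2)}

/-- The outputs `out` of the nodes are a correct `α`-approximate answer to `k`-`P` on `D`; the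
output `none` means "there is no solution of size `k`". -/
def Problem.Correct {V : Type} (P : Problem) (k : ℕ) (α : ℝ) (D : Digraph V) (ident : V → ℕ)
    (out : V → Option P.Label) : Prop :=
  (P.HasSolution D k → ∃ S : Set (P.Item V), P.IsApproxSolution D k α S ∧
    ∀ v, out v = some (P.label ident S v)) ∧
  (¬ P.HasSolution D k → ∀ v, out v = none)

/-- What a node knows at the start: its identifier and the identifiers at the other end of its
outgoing and of its incoming arcs (for an undirected graph these are the same set). -/
structure LocalInput where
  ident : ℕ
  outNbrs : Set ℕ
  inNbrs : Set ℕ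

/-- A deterministic LOCAL algorithm: states, messages of unbounded size, initialization, the message
sent to the neighbour with a given identifier (it may differ from neighbour to neighbour), the
update of the state on receipt of the messages (each tagged with the identifier of its sender), and
the output. -/
structure LocalAlg (Out : Type) where
  State : Type
  Msg : Type
  init : LocalInput → State
  send : State → ℕ → Msg
  recv : State → Set (ℕ × Msg) → State
  output : State → Out

/-- The initial input of node `v`. -/
def localInput {V : Type} (D : Digraph V) (ident : V → ℕ) (v : V) : LocalInput where
  ident := ident v
  outNbrs := ident '' {u | D.Adj v u}
  inNbrs := ident '' {u | D.Adj u v}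

/-- The state of each node after `t` synchronous rounds. -/
def LocalAlg.stateAt {Out V : Type} (A : LocalAlg Out) (D : Digraph V) (ident : V → ℕ) :
    ℕ → V → A.State
  | 0, v => A.init (localInput D ident v)
  | t + 1, v => A.recv (A.stateAt D ident t v)
      {m | ∃ u, (commGraph D).Adj v u ∧ m = (ident u, A.send (A.stateAt D ident t u) (ident v))}

/-- The outputs of the nodes after `T` rounds. -/
def LocalAlg.run {Out V : Type} (A : LocalAlg Out) (D : Digraph V) (ident : V → ℕ) (T : ℕ) (v : V) :
    Out :=
  A.output (A.stateAt D ident T v)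

/-- A randomized LOCAL algorithm: a random deterministic one. The randomness may be shared by the
nodes; private coins are the case in which `ω` is a family of independent random strings, one for
each identifier, of which the node with identifier `i` uses only the `i`-th. Deterministic
algorithms are the case of a one-point space. -/
structure RandLocalAlg (Out : Type) where
  Ω : Type
  [mΩ : MeasurableSpace Ω]
  μ : MeasureTheory.Measure Ω
  [prob : MeasureTheory.IsProbabilityMeasure μ]
  alg : Ω → LocalAlg Out

/-- On `D`, for every assignment of distinct identifiers from `I` to the nodes, running the algorithm
for `T` rounds gives, with probability at least `1 - δ`, a correct `α`-approximate answer to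
`k`-`P`. (The error probability is an outer measure, so no measurability is presupposed.) -/
def RandLocalAlg.SolvesOn {V : Type} {P : Problem} (A : RandLocalAlg (Option P.Label))
    (D : Digraph V) (I : Finset ℕ) (T k : ℕ) (α δ : ℝ) : Prop :=
  ∀ ident : V → ℕ, Function.Injective ident → (∀ v, ident v ∈ I) →
    A.μ {ω | ¬ P.Correct k α D ident ((A.alg ω).run D ident T)} ≤ ENNReal.ofReal δ

end ParamLocal

open ParamLocal

/-! Each problem gets an instance that is a chain of about `2 * k` blocks, translation invariant
away from its ends, plus padding that makes the graph arbitrarily large without changing the optimum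
`k`. One bit of the solution is read off at each block. In an optimal solution the bits alternate
along the chain, and a solution that misses the optimum by `b` has at most `2 * b` defects, that is,
places where two consecutive bits agree (`IsChain.rigid`).

Fix identifiers and choose `4 * b + 1` disjoint windows of `12 * T + 16` blocks. The second
assignment moves the identifiers in the first half of every window one block along the chain and
keeps those in the second half. In `T` rounds a node deep inside either half sees the same in both
runs (`LocalAlg.stateAt_perm`, `IsChain.run_perm`). So in the first half the bits of the second
solution are those of the first moved by one block, and in the second half they are unmoved. If both
solutions alternated throughout the window, the parities would clash. Every window thus holds a
defect of one of the solutions, but the two have at most `4 * b` defects together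
(`IsChain.exists_idents`).

Only two assignments are compared, so an error probability below `1 / 2` leaves an outcome that is
correct on both (`RandLocalAlg.exists_correct_pair`). The windows therefore cannot fit into the
chain, which bounds `T` from below. Taking `b = ⌊ε * k⌋₊` gives the first part, `b = 0` the second.
-/

namespace ParamLocal

/-! ### Locality: relabelling along a partial isomorphism -/

/-- If `σ` is an isomorphism on the set `B 0`, then moving the identifiers along `σ` moves the
states along. The sets `B t` shrink at least as fast as information travels. -/
theorem LocalAlg.stateAt_perm {Out V : Type} (A : LocalAlg Out) (D : Digraph V)
    (σ : Equiv.Perm V) (ident : V → ℕ) (B : ℕ → Set V) (hmono : ∀ t, B (t + 1) ⊆ B t)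
    (hB : ∀ t, ∀ w ∈ B (t + 1), ∀ x, (commGraph D).Adj w x → x ∈ B t)
    (hout : ∀ w ∈ B 0, ∀ x, D.Adj (σ w) (σ x) ↔ D.Adj w x)
    (hin : ∀ w ∈ B 0, ∀ x, D.Adj (σ x) (σ w) ↔ D.Adj x w) (t : ℕ) :
    ∀ w ∈ B t, A.stateAt D (ident ∘ σ.symm) t (σ w) = A.stateAt D ident t w := by
  have hB0 : ∀ t, B t ⊆ B 0 := by
    intro t
    induction t with
    | zero => exact subset_rfl
    | succ t ih => exact (hmono t).trans ih
  induction t with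
  | zero =>
    intro w hw
    have h1 : (ident ∘ σ.symm) '' {u | D.Adj (σ w) u} = ident '' {u | D.Adj w u} := by
      rw [Set.image_comp]
      congr 1
      ext x
      rw [Equiv.image_symm_eq_preimage]
      exact hout w hw x
    have h2 : (ident ∘ σ.symm) '' {u | D.Adj u (σ w)} = ident '' {u | D.Adj u w} := by
      rw [Set.image_comp]
      congr 1
      ext x
      rw [Equiv.image_symm_eq_preimage]
      exact hin w hw x
    simp only [LocalAlg.stateAt, localInput, h1, h2]
    simp
  | succ t ih =>
    intro w hw
    have hcomm : ∀ x, (commGraph D).Adj (σ w) (σ x) ↔ (commGraph D).Adj w x := by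
      intro x
      have := hout w (hB0 _ hw) x
      have := hin w (hB0 _ hw) x
      simp_all [commGraph, Digraph.toSimpleGraphInclusive]
    simp only [LocalAlg.stateAt]
    rw [ih w (hmono t hw)]
    congr 1
    ext m
    constructor
    · rintro ⟨u, hu, rfl⟩
      obtain ⟨x, rfl⟩ := σ.surjective u
      rw [hcomm] at hu
      exact ⟨x, hu, by simp [ih x (hB t w hw x hu)]⟩
    · rintro ⟨x, hu, rfl⟩
      exact ⟨σ x, (hcomm x).2 hu, by simp [ih x (hB t w hw x hu)]⟩

/-! ### Permutations that rotate windows -/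

/-- The cyclic rotation of an interval of length `L`. The last `q` numbers wrap around; where they
go never matters. -/
theorem exists_perm_rotate (n s L q : ℕ) (hq : q ≤ L) (hs : s + L ≤ n) :
    ∃ σ : Equiv.Perm (Fin n), (∀ v : Fin n, s ≤ v.val → v.val + q < s + L → (σ v).val = v + q) ∧
      ∀ v : Fin n, (v.val < s ∨ s + L ≤ v.val) → σ v = v := by
  refine ⟨⟨fun v => ⟨if v.val < s ∨ s + L ≤ v.val then v.val else
      if v.val + q < s + L then v.val + q else v.val + q - L, by split_ifs <;> omega⟩,
    fun v => ⟨if v.val < s ∨ s + L ≤ v.val then v.val else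
      if s + q ≤ v.val then v.val - q else v.val + L - q, by split_ifs <;> omega⟩, ?_, ?_⟩, ?_, ?_⟩
  · intro v
    ext
    dsimp only
    split_ifs <;> omega
  · intro v
    ext
    dsimp only
    split_ifs <;> omega
  · intro v h1 h2
    simp only [Equiv.coe_fn_mk]
    split_ifs <;> omega
  · intro v h
    ext
    simp [h]

theorem exists_perm_rotate_many (n : ℕ) (s : ℕ → ℕ) (L q g : ℕ) (hq : q ≤ L)
    (hsep : ∀ i j, i < j → s i + L ≤ s j) (hs : ∀ j < g, s j + L ≤ n) :
    ∃ σ : Equiv.Perm (Fin n),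
      (∀ j < g, ∀ v : Fin n, s j ≤ v.val → v.val + q < s j + L → (σ v).val = v + q) ∧
      ∀ v : Fin n, (∀ j < g, v.val < s j ∨ s j + L ≤ v.val) → σ v = v := by
  induction g with
  | zero => exact ⟨1, by simp, by simp⟩
  | succ g ih =>
    obtain ⟨σ, h1, h2⟩ := ih fun j hj => hs j (by omega)
    obtain ⟨ρ, h3, h4⟩ := exists_perm_rotate n (s g) L q hq (hs g (by omega))
    refine ⟨σ * ρ, fun j hj v hv hv' => ?_, fun v hv => ?_⟩
    · rw [Equiv.Perm.mul_apply]
      rcases Nat.lt_succ_iff_lt_or_eq.1 hj with hj | rfl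
      · have := hsep j g hj
        rw [h4 v (by omega)]
        exact h1 j hj v hv hv'
      · have h5 := h3 v hv hv'
        rw [h2 (ρ v) fun i hi => ?_, h5]
        have := hsep i j hi
        omega
    · rw [Equiv.Perm.mul_apply, h4 v (hv g (by omega))]
      exact h2 v fun j hj => hv j (by omega)

/-! ### Chains and the views of their nodes -/

/-- A chain of about `2 k` blocks of `q` vertices each, on which near-optimal solutions alternate
(`bit S i` and `bit S (i + 1)` differ) at all but few places. -/
structure IsChain (P : Problem) (k n q : ℕ) (D : Digraph (Fin n))
    (bit : Set (P.Item (Fin n)) → ℕ → Prop) : Prop where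
  step : q = 1 ∨ q = 2
  card : 4 * k ≤ n
  -- The margins `4` and `10` keep clear of the two ends, in particular of the padding. The `3` is
  -- the largest difference of numbers along an edge, attained by the backward arcs of `cycleChain`.
  near : ∀ u v : Fin n, D.Adj u v →
    (4 ≤ u.val ∧ u.val + 10 ≤ q * (2 * k)) ∨ (4 ≤ v.val ∧ v.val + 10 ≤ q * (2 * k)) →
    u.val ≤ v.val + 3 ∧ v.val ≤ u.val + 3
  shift : ∀ u v u' v' : Fin n, u'.val = u.val + q → v'.val = v.val + q → 4 ≤ u.val → 4 ≤ v.val →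
    u'.val + 10 ≤ q * (2 * k) → v'.val + 10 ≤ q * (2 * k) → (D.Adj u' v' ↔ D.Adj u v)
  -- Edges and arcs are named by identifiers in the labels, so equal labels yield equal bits only if
  -- the identifiers of the vertices nearby agree as well.
  bit_congr : ∀ (id₁ id₂ : Fin n → ℕ), Function.Injective id₁ → Function.Injective id₂ →
    ∀ (S₁ S₂ : Set (P.Item (Fin n))) (i j : ℕ) (u w : Fin n), 4 ≤ i → 4 ≤ j →
    i + 10 ≤ 2 * k → j + 10 ≤ 2 * k → u.val = q * i → w.val = q * j →
    P.label id₁ S₁ u = P.label id₂ S₂ w →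
    (∀ x y : Fin n, x.val + q * j = y.val + q * i → x.val ≤ u.val + 2 → u.val ≤ x.val + 2 →
      id₁ x = id₂ y) →
    (bit S₁ i ↔ bit S₂ j)
  rigid : ∀ (S : Set (P.Item (Fin n))) (b : ℕ), P.Feasible D S → (P.IsMax → k ≤ S.ncard + b) →
    (¬ P.IsMax → S.ncard ≤ k + b) → ∀ F : Finset ℕ,
    (∀ i ∈ F, 4 ≤ i ∧ i + 10 ≤ 2 * k ∧ (bit S i ↔ bit S (i + 1))) → F.card ≤ 2 * b

namespace IsChain

variable {P : Problem} {k n q : ℕ} {D : Digraph (Fin n)} {bit : Set (P.Item (Fin n)) → ℕ → Prop}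

/-- Information travels at most `3` numbers per round, so after `r` rounds the interval on which the
runs agree has lost `3 * r` numbers at each end. The case `t = q` serves the moved halves of the
windows, `t = 0` the fixed halves. -/
theorem run_perm (h : IsChain P k n q D bit) {Out : Type} (A : LocalAlg Out)
    (σ : Equiv.Perm (Fin n)) (ident : Fin n → ℕ) (lo hi t T : ℕ) (ht : t = 0 ∨ t = q)
    (hlo : 7 ≤ lo) (hhi : hi + 20 ≤ q * (2 * k))
    (hσ : ∀ v : Fin n, lo ≤ v.val + 3 → v.val ≤ hi + 3 → (σ v).val = v.val + t)
    (w : Fin n) (hw : lo + 3 * T ≤ w.val) (hw' : w.val + 3 * T ≤ hi) :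
    A.run D (ident ∘ σ.symm) T (σ w) = A.run D ident T w := by
  have hq := h.step
  have key : ∀ w x : Fin n, lo ≤ w.val → w.val ≤ hi →
      (D.Adj (σ w) (σ x) ↔ D.Adj w x) ∧ (D.Adj (σ x) (σ w) ↔ D.Adj x w) := by
    intro w x h1 h2
    have e1 := hσ w (by omega) (by omega)
    by_cases hx : lo ≤ x.val + 3 ∧ x.val ≤ hi + 3
    · have e2 := hσ x hx.1 hx.2
      rcases ht with rfl | rfl
      · have e1' : σ w = w := Fin.ext (by omega)
        have e2' : σ x = x := Fin.ext (by omega)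
        rw [e1', e2']
        exact ⟨Iff.rfl, Iff.rfl⟩
      · exact ⟨h.shift _ _ _ _ e1 e2 (by omega) (by omega) (by omega) (by omega),
          h.shift _ _ _ _ e2 e1 (by omega) (by omega) (by omega) (by omega)⟩
    -- Were `σ x` close to `σ w`, then `σ x - t` would lie where `σ` is the shift by `t`;
    -- injectivity makes it equal to `x`, which was assumed to lie outside. Hence all four
    -- adjacencies fail.
    · have far : ¬ ((σ w).val ≤ (σ x).val + 3 ∧ (σ x).val ≤ (σ w).val + 3) := by
        intro hc
        have hlt : (σ x).val - t < n := by omega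
        have e3 := hσ ⟨(σ x).val - t, hlt⟩ (by simp only; omega) (by simp only; omega)
        have e4 : σ ⟨(σ x).val - t, hlt⟩ = σ x := Fin.ext (by simp only at e3; omega)
        have e5 := congrArg Fin.val (σ.injective e4)
        simp only at e5
        omega
      have c1 : ¬ D.Adj (σ w) (σ x) := fun hc => far (by
        have := h.near _ _ hc (Or.inl ⟨by omega, by omega⟩)
        omega)
      have c2 : ¬ D.Adj (σ x) (σ w) := fun hc => far (by
        have := h.near _ _ hc (Or.inr ⟨by omega, by omega⟩)
        omega)
      have c3 : ¬ D.Adj w x := fun hc => by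
        have := h.near _ _ hc (Or.inl ⟨by omega, by omega⟩)
        omega
      have c4 : ¬ D.Adj x w := fun hc => by
        have := h.near _ _ hc (Or.inr ⟨by omega, by omega⟩)
        omega
      tauto
  unfold LocalAlg.run
  congr 1
  refine A.stateAt_perm D σ ident (fun r => {v | lo + 3 * r ≤ v.val ∧ v.val + 3 * r ≤ hi})
    ?_ ?_ ?_ ?_ T w ⟨hw, hw'⟩
  · rintro r v ⟨h1, h2⟩
    constructor <;> omega
  · rintro r v ⟨h1, h2⟩ x hx
    obtain ⟨-, hx⟩ := (SimpleGraph.fromRel_adj _ _ _).1 hx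
    have : v.val ≤ x.val + 3 ∧ x.val ≤ v.val + 3 := by
      rcases hx with hx | hx
      · exact h.near _ _ hx (Or.inl ⟨by omega, by omega⟩)
      · exact (h.near _ _ hx (Or.inr ⟨by omega, by omega⟩)).symm
    constructor <;> omega
  · rintro v ⟨h1, h2⟩ x
    exact (key v x (by omega) (by omega)).1
  · rintro v ⟨h1, h2⟩ x
    exact (key v x (by omega) (by omega)).2

end IsChain

/-! ### Parity clash between two identifier assignments -/

theorem alternating_iff (p : ℕ → Prop) (a d : ℕ)
    (h : ∀ i, a ≤ i → i < a + d → ¬ (p i ↔ p (i + 1))) : p (a + d) ↔ (p a ↔ Even d) := by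
  induction d with
  | zero => simp
  | succ d ih =>
    have h1 := ih fun i hi hi' => h i hi (by omega)
    have h2 := h (a + d) (by omega) (by omega)
    rw [← add_assoc, Nat.even_add_one]
    tauto

namespace IsChain

variable {P : Problem} {k n q : ℕ} {D : Digraph (Fin n)} {bit : Set (P.Item (Fin n)) → ℕ → Prop}

/-- Two assignments of the identifiers such that no fast deterministic algorithm finds near-optimal
solutions on both. -/
theorem exists_idents (h : IsChain P k n q D bit) (T b : ℕ)
    (hsize : (4 * b + 1) * (12 * T + 16) + 40 ≤ 2 * k) (I : Finset ℕ) (hI : I.card = n) :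
    ∃ id₁ id₂ : Fin n → ℕ, (Function.Injective id₁ ∧ ∀ v, id₁ v ∈ I) ∧
      (Function.Injective id₂ ∧ ∀ v, id₂ v ∈ I) ∧
      ∀ (A : LocalAlg (Option P.Label)) (S₁ S₂ : Set (P.Item (Fin n))),
        P.Feasible D S₁ → (P.IsMax → k ≤ S₁.ncard + b) → (¬ P.IsMax → S₁.ncard ≤ k + b) →
        P.Feasible D S₂ → (P.IsMax → k ≤ S₂.ncard + b) → (¬ P.IsMax → S₂.ncard ≤ k + b) →
        (∀ v, A.run D id₁ T v = some (P.label id₁ S₁ v)) →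
        (∀ v, A.run D id₂ T v = some (P.label id₂ S₂ v)) → False := by
  classical
  -- Window `j` starts at block `e j`; its first `6 * T + 8` blocks are rotated by one block, its
  -- last `6 * T + 8` are fixed. Either half has room for `3 * T` numbers on both sides of a central
  -- block, even if `q = 1`.
  obtain ⟨e, he⟩ : ∃ e : ℕ → ℕ, ∀ j, e j = 10 + j * (12 * T + 16) := ⟨_, fun _ => rfl⟩
  have hsep : ∀ i j, i < j → e i + (12 * T + 16) ≤ e j := by
    intro i j hij
    have := Nat.mul_le_mul_right (12 * T + 16) (Nat.succ_le_of_lt hij)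
    rw [he, he]
    rw [Nat.succ_mul] at this
    omega
  have hlow : ∀ j, 10 ≤ e j := fun j => by rw [he]; omega
  have htop : ∀ j < 4 * b + 1, e j + (12 * T + 16) + 30 ≤ 2 * k := by
    intro j hj
    have := hsep j _ hj
    rw [he (4 * b + 1)] at this
    omega
  have hq := h.step
  have hcard := h.card
  obtain ⟨σ, hσ, hfix⟩ := exists_perm_rotate_many n (fun j => q * e j) (q * (6 * T + 8)) q
    (4 * b + 1) (by rcases hq with rfl | rfl <;> omega)
    (fun i j hij => by
      have := hsep i j hij
      rcases hq with rfl | rfl <;> omega)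
    (fun j hj => by
      have := htop j hj
      rcases hq with rfl | rfl <;> omega)
  have hfixB : ∀ j < 4 * b + 1, ∀ v : Fin n, q * (e j + (6 * T + 8)) ≤ v.val →
      v.val < q * (e j + (12 * T + 16)) → σ v = v := by
    intro j hj v h1 h2
    refine hfix v fun i hi => ?_
    rcases lt_trichotomy i j with hij | rfl | hij
    · have := hsep i j hij
      right
      rcases hq with rfl | rfl <;> omega
    · right
      rcases hq with rfl | rfl <;> omega
    · have := hsep j i hij
      left
      rcases hq with rfl | rfl <;> omega
  let f := I.equivFinOfCardEq hI
  have hf : Function.Injective fun v : Fin n => ((f.symm v : I) : ℕ) :=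
    Subtype.val_injective.comp f.symm.injective
  refine ⟨fun v => ((f.symm v : I) : ℕ), (fun v => ((f.symm v : I) : ℕ)) ∘ σ.symm,
    ⟨hf, fun v => (f.symm v).2⟩, ⟨hf.comp σ.symm.injective, fun v => (f.symm _).2⟩, ?_⟩
  generalize (fun v : Fin n => ((f.symm v : I) : ℕ)) = ident at hf
  intro A S₁ S₂ hS₁ hmax₁ hmin₁ hS₂ hmax₂ hmin₂ hr₁ hr₂
  have hidσ : ∀ x y, σ x = y → ident x = (ident ∘ σ.symm) y := by
    rintro x _ rfl
    simp
  -- A central block of the moved half: its node in the first run and the next block's node in the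
  -- second have the same view.
  have hA : ∀ j < 4 * b + 1, (bit S₁ (e j + (3 * T + 3)) ↔ bit S₂ (e j + (3 * T + 3) + 1)) := by
    intro j hj
    have h1 := htop j hj
    have h2 := hlow j
    have hlt : q * (e j + (3 * T + 3)) < n := by rcases hq with rfl | rfl <;> omega
    have hlt' : q * (e j + (3 * T + 3) + 1) < n := by rcases hq with rfl | rfl <;> omega
    have hu : σ ⟨_, hlt⟩ = ⟨_, hlt'⟩ := by
      apply Fin.ext
      rw [hσ j hj]
      · simp only
        rcases hq with rfl | rfl <;> omega
      · simp only
        rcases hq with rfl | rfl <;> omega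
      · simp only
        rcases hq with rfl | rfl <;> omega
    refine h.bit_congr ident (ident ∘ σ.symm) hf (hf.comp σ.symm.injective) S₁ S₂ _ _
      ⟨_, hlt⟩ ⟨_, hlt'⟩ (by omega) (by omega) (by omega) (by omega) rfl rfl ?_ ?_
    -- The interval is `3` short at each end because `run_perm` needs the shift on `3` further
    -- numbers.
    · have hrun := h.run_perm A σ ident (q * e j + 3) (q * (e j + (6 * T + 6)) - 3) q T
        (Or.inr rfl)
        (by rcases hq with rfl | rfl <;> omega) (by rcases hq with rfl | rfl <;> omega)
        (fun v hv hv' => hσ j hj v (by omega)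
          (by rcases hq with rfl | rfl <;> omega))
        ⟨_, hlt⟩ (by simp only; rcases hq with rfl | rfl <;> omega)
        (by simp only; rcases hq with rfl | rfl <;> omega)
      rw [hu, hr₁, hr₂] at hrun
      exact (Option.some.inj hrun).symm
    · intro x y hxy hx hx'
      apply hidσ
      apply Fin.ext
      simp only at hx hx'
      rw [hσ j hj x (by rcases hq with rfl | rfl <;> omega)
        (by rcases hq with rfl | rfl <;> omega)]
      rcases hq with rfl | rfl <;> omega
  have hB : ∀ j < 4 * b + 1, (bit S₁ (e j + (9 * T + 11)) ↔ bit S₂ (e j + (9 * T + 11))) := by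
    intro j hj
    have h1 := htop j hj
    have h2 := hlow j
    have hlt : q * (e j + (9 * T + 11)) < n := by rcases hq with rfl | rfl <;> omega
    have hu : σ ⟨_, hlt⟩ = ⟨_, hlt⟩ :=
      hfixB j hj _ (by simp only; rcases hq with rfl | rfl <;> omega)
        (by simp only; rcases hq with rfl | rfl <;> omega)
    refine h.bit_congr ident (ident ∘ σ.symm) hf (hf.comp σ.symm.injective) S₁ S₂ _ _
      ⟨_, hlt⟩ ⟨_, hlt⟩ (by omega) (by omega) (by omega) (by omega) rfl rfl ?_ ?_
    · have hrun := h.run_perm A σ ident (q * (e j + (6 * T + 8)) + 3)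
        (q * (e j + (12 * T + 15)) - 3) 0 T (Or.inl rfl)
        (by rcases hq with rfl | rfl <;> omega) (by rcases hq with rfl | rfl <;> omega)
        (fun v hv hv' => by
          rw [hfixB j hj v (by omega) (by rcases hq with rfl | rfl <;> omega), add_zero])
        ⟨_, hlt⟩ (by simp only; rcases hq with rfl | rfl <;> omega)
        (by simp only; rcases hq with rfl | rfl <;> omega)
      rw [hu, hr₁, hr₂] at hrun
      exact (Option.some.inj hrun).symm
    · intro x y hxy hx hx'
      apply hidσ
      simp only at hx hx'
      rw [hfixB j hj x (by rcases hq with rfl | rfl <;> omega)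
        (by rcases hq with rfl | rfl <;> omega)]
      exact Fin.ext (by omega)
  -- Between the two reference blocks there are `6 * T + 8` steps for the first solution but only `6
  -- * T + 7` for the second, with equal bits at corresponding ends. Both cannot alternate all the
  -- way.
  have hdef : ∀ j < 4 * b + 1, ∃ i, e j ≤ i ∧ i < e j + (12 * T + 16) ∧
      ((bit S₁ i ↔ bit S₁ (i + 1)) ∨ (bit S₂ i ↔ bit S₂ (i + 1))) := by
    intro j hj
    by_contra hcon
    have a1 := alternating_iff (bit S₁) (e j + (3 * T + 3)) (6 * T + 8)
      fun i hi hi' hc => hcon ⟨i, by omega, by omega, Or.inl hc⟩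
    have a2 := alternating_iff (bit S₂) (e j + (3 * T + 3) + 1) (6 * T + 7)
      fun i hi hi' hc => hcon ⟨i, by omega, by omega, Or.inr hc⟩
    rw [show e j + (3 * T + 3) + (6 * T + 8) = e j + (9 * T + 11) by ring] at a1
    rw [show e j + (3 * T + 3) + 1 + (6 * T + 7) = e j + (9 * T + 11) by ring] at a2
    have hev : Even (6 * T + 8) := ⟨3 * T + 4, by ring⟩
    have hodd : ¬ Even (6 * T + 7) := by
      rw [Nat.not_even_iff_odd]
      exact ⟨3 * T + 3, by ring⟩
    rw [iff_true_right hev] at a1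
    rw [iff_false_right hodd, ← hA j hj, ← hB j hj] at a2
    exact iff_not_self (a1.symm.trans a2)
  -- The windows are disjoint, so choosing a defect in each gives `4 * b + 1` distinct ones.
  choose! d hd1 hd2 hd3 using hdef
  set F₁ := (Finset.range (2 * k)).filter
    fun i => 4 ≤ i ∧ i + 10 ≤ 2 * k ∧ (bit S₁ i ↔ bit S₁ (i + 1)) with hF₁
  set F₂ := (Finset.range (2 * k)).filter
    fun i => 4 ≤ i ∧ i + 10 ≤ 2 * k ∧ (bit S₂ i ↔ bit S₂ (i + 1)) with hF₂
  have c1 : F₁.card ≤ 2 * b := h.rigid S₁ b hS₁ hmax₁ hmin₁ F₁ fun i hi =>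
    (Finset.mem_filter.1 hi).2
  have c2 : F₂.card ≤ 2 * b := h.rigid S₂ b hS₂ hmax₂ hmin₂ F₂ fun i hi =>
    (Finset.mem_filter.1 hi).2
  have c3 : (Finset.range (4 * b + 1)).card ≤ (F₁ ∪ F₂).card := by
    refine Finset.card_le_card_of_injOn d (fun j hj => ?_) (fun i hi j hj hij => ?_)
    · have hj : j < 4 * b + 1 := by simpa using hj
      have := hd1 j hj
      have := hd2 j hj
      have := htop j hj
      have := hlow j
      simp only [hF₁, hF₂, Finset.coe_union, Set.mem_union, Finset.mem_coe, Finset.mem_filter,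
        Finset.mem_range]
      rcases hd3 j hj with h3 | h3
      · exact Or.inl ⟨by omega, by omega, by omega, h3⟩
      · exact Or.inr ⟨by omega, by omega, by omega, h3⟩
    · have hi : i < 4 * b + 1 := by simpa using hi
      have hj : j < 4 * b + 1 := by simpa using hj
      have := hd1 j hj
      have := hd2 j hj
      have := hd1 i hi
      have := hd2 i hi
      rcases lt_trichotomy i j with hlt | heq | hlt
      · have := hsep i j hlt
        omega
      · exact heq
      · have := hsep j i hlt
        omega
  have c4 := Finset.card_union_le F₁ F₂
  rw [Finset.card_range] at c3
  omega

end IsChain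

/-! ### From random to deterministic algorithms -/

/-- The two failure events have total measure below `1`, so they do not cover the probability space.
Only subadditivity is used, which outer measures also satisfy. -/
theorem RandLocalAlg.exists_correct_pair {V : Type} {P : Problem}
    (A : RandLocalAlg (Option P.Label)) (D : Digraph V) (I : Finset ℕ) (T k : ℕ) (α δ : ℝ)
    (hδ : δ < 1 / 2) (hA : A.SolvesOn D I T k α δ) (id₁ id₂ : V → ℕ)
    (h₁ : Function.Injective id₁ ∧ ∀ v, id₁ v ∈ I) (h₂ : Function.Injective id₂ ∧ ∀ v, id₂ v ∈ I) :
    ∃ ω, P.Correct k α D id₁ ((A.alg ω).run D id₁ T) ∧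
      P.Correct k α D id₂ ((A.alg ω).run D id₂ T) := by
  by_contra! hcon
  have e1 := hA id₁ h₁.1 h₁.2
  have e2 := hA id₂ h₂.1 h₂.2
  let _ := A.mΩ
  have := A.prob
  have hle : A.μ Set.univ ≤ ENNReal.ofReal δ + ENNReal.ofReal δ := by
    refine le_trans (MeasureTheory.measure_mono fun ω _ => ?_)
      ((MeasureTheory.measure_union_le _ _).trans (add_le_add e1 e2))
    by_cases h : P.Correct k α D id₁ ((A.alg ω).run D id₁ T)
    · exact Or.inr (hcon ω h)
    · exact Or.inl h
  rw [MeasureTheory.measure_univ] at hle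
  have hhalf : ENNReal.ofReal δ < ENNReal.ofReal (1 / 2) :=
    (ENNReal.ofReal_lt_ofReal_iff (by norm_num)).2 hδ
  have hlt := ENNReal.add_lt_add hhalf hhalf
  rw [← ENNReal.ofReal_add (p := 1 / 2) (by norm_num) (by norm_num), add_halves,
    ENNReal.ofReal_one] at hlt
  exact absurd (hle.trans_lt hlt) (lt_irrefl _)

/-- As sizes are integers, a relative error `ε` with `ε * k < b + 1` is an additive error of at most
`b`. -/
theorem IsChain.lt_of_solvesOn {P : Problem} {k n q : ℕ} {D : Digraph (Fin n)}
    {bit : Set (P.Item (Fin n)) → ℕ → Prop} (h : IsChain P k n q D bit)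
    (hsol : P.HasSolution D k) (I : Finset ℕ) (hI : I.card = n)
    (A : RandLocalAlg (Option P.Label)) (T b : ℕ) (ε δ : ℝ) (hε : 0 ≤ ε) (hb : ε * k < b + 1)
    (hδ : δ < 1 / 2) (hA : A.SolvesOn D I T k (1 + ε) δ) :
    2 * k < (4 * b + 1) * (12 * T + 16) + 40 := by
  by_contra! hsize
  obtain ⟨id₁, id₂, h₁, h₂, hfail⟩ := h.exists_idents T b hsize I hI
  obtain ⟨ω, hω₁, hω₂⟩ := A.exists_correct_pair D I T k (1 + ε) δ hδ hA id₁ id₂ h₁ h₂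
  obtain ⟨S₁, ⟨f₁, max₁, min₁⟩, out₁⟩ := hω₁.1 hsol
  obtain ⟨S₂, ⟨f₂, max₂, min₂⟩, out₂⟩ := hω₂.1 hsol
  have hmin : ∀ m : ℕ, (m : ℝ) ≤ (1 + ε) * k → m ≤ k + b := by
    intro m hm
    have : (m : ℝ) < ((k + b + 1 : ℕ) : ℝ) := by push_cast; linarith
    have := Nat.cast_lt.1 this
    omega
  have hmax : ∀ m : ℕ, (k : ℝ) / (1 + ε) ≤ m → k ≤ m + b := by
    intro m hm
    have hk : (0 : ℝ) ≤ k := Nat.cast_nonneg k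
    -- This follows from `(1 - ε) * (1 + ε) ≤ 1`.
    have h1 : (k : ℝ) * (1 - ε) ≤ k / (1 + ε) := by
      rw [le_div_iff₀ (by linarith)]
      nlinarith [mul_nonneg hk (mul_nonneg hε hε)]
    have : (k : ℝ) < ((m + b + 1 : ℕ) : ℝ) := by push_cast; linarith
    have := Nat.cast_lt.1 this
    omega
  exact hfail (A.alg ω) S₁ S₂ f₁ (fun hP => hmax _ (max₁ hP)) (fun hP => hmin _ (min₁ hP))
    f₂ (fun hP => hmax _ (max₂ hP)) (fun hP => hmin _ (min₂ hP)) out₁ out₂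

/-! ### Counting: defects cost half a unit each -/

theorem card_filter_lt_succ (Z : Finset ℕ) (m : ℕ) :
    (Z.filter (· < m + 1)).card = (Z.filter (· < m)).card + if m ∈ Z then 1 else 0 := by
  have h : Z.filter (· < m + 1) = Z.filter (· < m) ∪ Z.filter (· = m) := by
    ext x
    simp only [Finset.mem_union, Finset.mem_filter]
    rw [← and_or_left, Nat.lt_succ_iff_lt_or_eq]
  rw [h, Finset.card_union_of_disjoint, Finset.filter_eq']
  · split_ifs <;> simp
  · rw [Finset.disjoint_left]
    intro x hx hx'
    simp only [Finset.mem_filter] at hx hx'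
    omega

/-- Let an even element of `Z` give weight `1` to each of the two triples around it and an odd one
weight `2` to its only triple. The total is at most `2 * Z.card` and every triple gets at least `1`.
A triple in `F` gets at least `2`: it contains either both of its even numbers or neither, hence the
odd one. -/
theorem two_mul_add_card_le (Z F : Finset ℕ) (k : ℕ)
    (hZ : ∀ i < 2 * k, 2 * i ∈ Z ∨ 2 * i + 1 ∈ Z ∨ 2 * i + 2 ∈ Z)
    (hF : ∀ i ∈ F, i < 2 * k ∧ (2 * i ∈ Z ↔ 2 * i + 2 ∈ Z)) :
    2 * k + F.card ≤ 2 * Z.card := by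
  -- The indicator of `2 * m ∈ Z` is the weight reserved for the next triple.
  have key : ∀ m ≤ 2 * k, m + (F.filter (· < m)).card + (if 2 * m ∈ Z then 1 else 0) ≤
      2 * (Z.filter (· < 2 * m + 1)).card := by
    intro m
    induction m with
    | zero =>
      intro _
      rw [card_filter_lt_succ]
      simp only [not_lt_zero, Finset.filter_false, Finset.card_empty]
      split_ifs <;> omega
    | succ m ih =>
      intro hm
      have h0 := ih (by omega)
      have h1 := hZ m (by omega)
      have h2 := hF m
      rw [show 2 * (m + 1) + 1 = 2 * m + 1 + 1 + 1 by ring, card_filter_lt_succ Z,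
        card_filter_lt_succ Z, card_filter_lt_succ F, show 2 * (m + 1) = 2 * m + 1 + 1 by ring]
      by_cases c0 : 2 * m ∈ Z <;> by_cases c1 : 2 * m + 1 ∈ Z <;>
        by_cases c2 : 2 * m + 1 + 1 ∈ Z <;> by_cases c3 : m ∈ F <;>
        simp only [c0, c1, c2, c3, if_true, if_false] at h0 h1 h2 ⊢ <;>
        first
          | omega
          | (simp at h1; done)
          | simp at h2
  have h := key (2 * k) le_rfl
  have h1 : F.filter (· < 2 * k) = F := Finset.filter_true_of_mem fun i hi => (hF i hi).1
  have h2 := Finset.card_filter_le Z (· < 2 * (2 * k) + 1)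
  rw [h1] at h
  omega

/-- A set that hits every triple `2 i, 2 i + 1, 2 i + 2`, where `i < 2 k`, has at least `k` elements,
and it is larger if membership of the even numbers does not alternate. -/
theorem two_mul_add_card_le_ncard {α : Type*} [Finite α] (S : Set α) (π : α → ℕ) (k : ℕ)
    (hcov : ∀ i < 2 * k, ∃ s ∈ S, π s = 2 * i ∨ π s = 2 * i + 1 ∨ π s = 2 * i + 2)
    (F : Finset ℕ)
    (hF : ∀ i ∈ F, i < 2 * k ∧ ((∃ s ∈ S, π s = 2 * i) ↔ ∃ s ∈ S, π s = 2 * (i + 1))) :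
    2 * k + F.card ≤ 2 * S.ncard := by
  classical
  have hfin : S.Finite := Set.toFinite S
  have hmem : ∀ x, x ∈ hfin.toFinset.image π ↔ ∃ s ∈ S, π s = x := by simp
  have h1 : (hfin.toFinset.image π).card ≤ S.ncard := by
    rw [Set.ncard_eq_toFinset_card S hfin]
    exact Finset.card_image_le
  have h2 := two_mul_add_card_le (hfin.toFinset.image π) F k
    (fun i hi => by
      obtain ⟨s, hs, h⟩ := hcov i hi
      simp only [hmem]
      rcases h with h | h | h
      · exact Or.inl ⟨s, hs, h⟩
      · exact Or.inr (Or.inl ⟨s, hs, h⟩)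
      · exact Or.inr (Or.inr ⟨s, hs, h⟩))
    (fun i hi => by
      simp only [hmem]
      exact hF i hi)
  omega

/-- A set of numbers below `2 k - 1` without consecutive elements has at most `k` elements, and it is
smaller if membership does not alternate. -/
theorem two_mul_ncard_add_card_le {α : Type*} [Finite α] (S : Set α) (π : α → ℕ) (k : ℕ)
    (hk : 0 < k) (hinj : Set.InjOn π S) (hlt : ∀ s ∈ S, π s < 2 * k - 1)
    (hindep : ∀ s ∈ S, ∀ t ∈ S, π t ≠ π s + 1)
    (F : Finset ℕ)
    (hF : ∀ i ∈ F, i + 1 < 2 * k - 1 ∧ ((∃ s ∈ S, π s = i) ↔ ∃ s ∈ S, π s = i + 1)) :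
    2 * S.ncard + F.card ≤ 2 * k := by
  classical
  have hfin : S.Finite := Set.toFinite S
  have hmem : ∀ x, x ∈ hfin.toFinset.image π ↔ ∃ s ∈ S, π s = x := by simp
  have h1 : (hfin.toFinset.image π).card = S.ncard := by
    rw [Set.ncard_eq_toFinset_card S hfin]
    exact Finset.card_image_of_injOn (by simpa using hinj)
  have hsub : hfin.toFinset.image π ⊆ Finset.range (2 * k - 1) := by
    intro x hx
    obtain ⟨s, hs, rfl⟩ := (hmem x).1 hx
    exact Finset.mem_range.2 (hlt s hs)
  have h2 := Finset.card_sdiff_add_card_eq_card hsub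
  -- The complement, doubled, hits all triples: of two consecutive numbers at least one is missing
  -- from the independent set. The `2 * k - 1` numbers form `2 * (k - 1)` such pairs, so the
  -- covering bound is applied with `k - 1`.
  have hZ : ∀ i, 2 * i ∈ (Finset.range (2 * k - 1) \ hfin.toFinset.image π).image (2 * ·) ↔
      i < 2 * k - 1 ∧ ¬ ∃ s ∈ S, π s = i := by
    intro i
    simp only [Finset.mem_image, Finset.mem_sdiff, Finset.mem_range, Set.Finite.mem_toFinset]
    constructor
    · rintro ⟨a, ha, hai⟩
      obtain rfl : a = i := by omega
      exact ha
    · exact fun h => ⟨i, h, rfl⟩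
  have h3 := two_mul_add_card_le
    ((Finset.range (2 * k - 1) \ hfin.toFinset.image π).image (2 * ·)) F (k - 1)
    (fun i hi => by
      have hi₀ : i < 2 * k - 1 := by omega
      have hi₁ : i + 1 < 2 * k - 1 := by omega
      by_contra hc
      rw [show 2 * i + 2 = 2 * (i + 1) by ring, hZ, hZ] at hc
      have e1 : ∃ s ∈ S, π s = i := by
        by_contra hs
        exact hc (Or.inl ⟨hi₀, hs⟩)
      have e2 : ∃ s ∈ S, π s = i + 1 := by
        by_contra hs
        exact hc (Or.inr (Or.inr ⟨hi₁, hs⟩))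
      obtain ⟨s, hs, rfl⟩ := e1
      obtain ⟨t, ht, ht'⟩ := e2
      exact hindep s hs t ht ht')
    (fun i hi => by
      obtain ⟨e1, e2⟩ := hF i hi
      refine ⟨by omega, ?_⟩
      rw [show 2 * i + 2 = 2 * (i + 1) by ring, hZ, hZ, e2]
      have : i < 2 * k - 1 := by omega
      simp only [this, e1])
  have h4 := Finset.card_image_le (s := Finset.range (2 * k - 1) \ hfin.toFinset.image π)
    (f := (2 * ·))
  rw [Finset.card_range] at h2
  omega

/-! ### Connectivity, solutions of size `k`, and the bits -/

theorem connected_of_exists_lt {n : ℕ} (hn : 0 < n) (G : SimpleGraph (Fin n))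
    (h : ∀ v : Fin n, 0 < v.val → ∃ u : Fin n, u.val < v.val ∧ G.Adj u v) : G.Connected := by
  have key : ∀ m, ∀ v : Fin n, v.val = m → G.Reachable ⟨0, hn⟩ v := by
    intro m
    induction m using Nat.strong_induction_on with
    | _ m ih =>
      intro v hv
      rcases Nat.eq_zero_or_pos v.val with h0 | h0
      · rw [show v = ⟨0, hn⟩ from Fin.ext h0]
      · obtain ⟨u, hu, huv⟩ := h v h0
        exact (ih u.val (by omega) u rfl).trans huv.reachable
  have : Nonempty (Fin n) := ⟨⟨0, hn⟩⟩
  exact ⟨fun u v => (key _ u rfl).symm.trans (key _ v rfl)⟩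

theorem commGraph_adj {V : Type} (D : Digraph V) (u v : V) :
    (commGraph D).Adj u v ↔ u ≠ v ∧ (D.Adj u v ∨ D.Adj v u) :=
  SimpleGraph.fromRel_adj _ _ _

theorem Problem.HasSolution.of_min {V : Type} {P : Problem} (hP : ¬ P.IsMax) {D : Digraph V}
    {k : ℕ} (f : Fin k → P.Item V) (hf : P.Feasible D (Set.range f)) : P.HasSolution D k := by
  refine ⟨_, hf, fun h => absurd h hP, fun _ => ?_⟩
  rw [one_mul, Nat.cast_le, ← Set.image_univ]
  exact (Set.ncard_image_le Set.finite_univ).trans (by simp [Set.ncard_univ])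

theorem Problem.HasSolution.of_max {V : Type} {P : Problem} (hP : P.IsMax) {D : Digraph V}
    {k : ℕ} (f : Fin k → P.Item V) (hf : P.Feasible D (Set.range f))
    (hinj : Function.Injective f) : P.HasSolution D k := by
  refine ⟨_, hf, fun _ => ?_, fun h => absurd hP h⟩
  rw [div_one, Nat.cast_le, ← Set.image_univ, Set.ncard_image_of_injective _ hinj]
  simp [Set.ncard_univ]

/-- Membership of the vertex number `q * i`. -/
def vertexBit {n : ℕ} (q : ℕ) (S : Set (Fin n)) (i : ℕ) : Prop := ∃ u ∈ S, u.val = q * i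

theorem vertexBit_congr {n q : ℕ} (S₁ S₂ : Set (Fin n)) (i j : ℕ) (u w : Fin n)
    (hu : u.val = q * i) (hw : w.val = q * j) (h : (u ∈ S₁) = (w ∈ S₂)) :
    vertexBit q S₁ i ↔ vertexBit q S₂ j := by
  have e1 : vertexBit q S₁ i ↔ u ∈ S₁ :=
    ⟨fun ⟨x, hx, hx'⟩ => (Fin.ext (hx'.trans hu.symm) : x = u) ▸ hx, fun h => ⟨u, h, hu⟩⟩
  have e2 : vertexBit q S₂ j ↔ w ∈ S₂ :=
    ⟨fun ⟨x, hx, hx'⟩ => (Fin.ext (hx'.trans hw.symm) : x = w) ▸ hx, fun h => ⟨w, h, hw⟩⟩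
  rw [e1, e2, h]

theorem mem_edgeLabel {V : Type} {ident : V → ℕ} (hid : Function.Injective ident)
    (Y : Set (Sym2 V)) (u x : V) :
    s(ident x, ident u) ∈ {f | ∃ e ∈ Y, u ∈ e ∧ f = e.map ident} ↔ s(x, u) ∈ Y := by
  constructor
  · rintro ⟨e, he, -, h⟩
    rw [← Sym2.map_mk] at h
    rwa [Sym2.map.injective hid h]
  · exact fun h => ⟨_, h, Sym2.mem_mk_right _ _, by simp⟩

/-- Membership of the edge between the vertices number `a i` and `c i`. -/
def edgeBit {n : ℕ} (a c : ℕ → ℕ) (Y : Set (Sym2 (Fin n))) (i : ℕ) : Prop :=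
  ∃ x u : Fin n, x.val = a i ∧ u.val = c i ∧ s(x, u) ∈ Y

theorem edgeBit_congr {n : ℕ} {a c : ℕ → ℕ} {id₁ id₂ : Fin n → ℕ} (h₁ : Function.Injective id₁)
    (h₂ : Function.Injective id₂) (Y₁ Y₂ : Set (Sym2 (Fin n))) (i j : ℕ) (u w x y : Fin n)
    (hu : u.val = c i) (hw : w.val = c j) (hx : x.val = a i) (hy : y.val = a j)
    (huw : id₁ u = id₂ w) (hxy : id₁ x = id₂ y)
    (h : {f | ∃ e ∈ Y₁, u ∈ e ∧ f = e.map id₁} = {f | ∃ e ∈ Y₂, w ∈ e ∧ f = e.map id₂}) :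
    edgeBit a c Y₁ i ↔ edgeBit a c Y₂ j := by
  have e1 : edgeBit a c Y₁ i ↔ s(x, u) ∈ Y₁ := by
    constructor
    · rintro ⟨x', u', hx', hu', he⟩
      rwa [(Fin.ext (hx'.trans hx.symm) : x' = x), (Fin.ext (hu'.trans hu.symm) : u' = u)] at he
    · exact fun he => ⟨x, u, hx, hu, he⟩
  have e2 : edgeBit a c Y₂ j ↔ s(y, w) ∈ Y₂ := by
    constructor
    · rintro ⟨x', u', hx', hu', he⟩
      rwa [(Fin.ext (hx'.trans hy.symm) : x' = y), (Fin.ext (hu'.trans hw.symm) : u' = w)] at he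
    · exact fun he => ⟨y, w, hy, hw, he⟩
  rw [e1, e2, ← mem_edgeLabel h₁, ← mem_edgeLabel h₂, h, huw, hxy]

/-- Membership of the arc from vertex number `2 i` to the next one. -/
def arcBit {n : ℕ} (Y : Set (Fin n × Fin n)) (i : ℕ) : Prop :=
  ∃ x u : Fin n, x.val = 2 * i ∧ u.val = 2 * i + 1 ∧ (x, u) ∈ Y

/-! ### The hard instances -/

/-- The path `0, 1, …, m` with the last vertex replaced by the independent set of all vertices
from `m` on. -/
def broomPath (n m : ℕ) : Digraph (Fin n) where
  Adj u v := min u.val m + 1 = min v.val m ∨ min v.val m + 1 = min u.val m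

/-- The path `0, 1, …, m` with the last vertex replaced by the clique of all vertices from `m` on. -/
def cliquePath (n m : ℕ) : Digraph (Fin n) where
  Adj u v := u ≠ v ∧ min u.val m ≤ min v.val m + 1 ∧ min v.val m ≤ min u.val m + 1

/-- A strip of the triangles `2 i, 2 i + 1, 2 i + 2` for `i < 2 k`, with pendant vertices at
`4 k - 2`. -/
def triangleStrip (n k : ℕ) : Digraph (Fin n) where
  Adj u v :=
    (v.val ≤ 4 * k ∧ (v.val = u.val + 1 ∨ (u.val % 2 = 0 ∧ v.val = u.val + 2)) ∨
      (4 * k < v.val ∧ u.val + 2 = 4 * k)) ∨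
    (u.val ≤ 4 * k ∧ (u.val = v.val + 1 ∨ (v.val % 2 = 0 ∧ u.val = v.val + 2)) ∨
      (4 * k < u.val ∧ v.val + 2 = 4 * k))

/-- The path of the even numbers up to `4 k - 2` with a pendant vertex at each of them, and further
ones at the last. -/
def comb (n k : ℕ) : Digraph (Fin n) where
  Adj u v :=
    (u.val % 2 = 0 ∧ ((v.val < 4 * k ∧ (v.val = u.val + 1 ∨ v.val = u.val + 2)) ∨
      (4 * k ≤ v.val ∧ u.val + 2 = 4 * k))) ∨
    (v.val % 2 = 0 ∧ ((u.val < 4 * k ∧ (u.val = v.val + 1 ∨ u.val = v.val + 2)) ∨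
      (4 * k ≤ u.val ∧ v.val + 2 = 4 * k)))

/-- A chain of the directed cycles `2 i, 2 i + 1, 2 i + 2, 2 i + 3` for `i < 2 k`, with arcs from
`4 k` to all later vertices. -/
def cycleChain (n k : ℕ) : Digraph (Fin n) where
  Adj u v :=
    (u.val ≤ 4 * k ∧ v.val = u.val + 1) ∨
    (u.val % 2 = 1 ∧ u.val ≤ 4 * k + 1 ∧ u.val = v.val + 3) ∨
    (u.val = 4 * k ∧ 4 * k < v.val)

/-- A connected instance with exactly the features that the lower bound needs. -/
def Problem.HasChain (P : Problem) (k n : ℕ) : Prop :=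
  ∃ D : Digraph (Fin n), P.IsInstance D ∧ (commGraph D).Connected ∧ P.HasSolution D k ∧
    ∃ (q : ℕ) (bit : Set (P.Item (Fin n)) → ℕ → Prop), IsChain P k n q D bit

/-! ### Paths: vertex cover, independent set, matching -/

/-- The odd numbers below `2 * k` form a cover, which contains the only neighbour `2 * k - 1` of the
padding. For the counting, vertex `v` has number `2 * v`, so that edge `i, i + 1` is triple `i`
without its middle. -/
theorem hasChain_MVC {k n : ℕ} (hk : 10 ≤ k) (hn : 4 * k + 10 ≤ n) :
    Problem.MVC.HasChain k n := by
  have hadj : ∀ u v : Fin n, (commGraph (broomPath n (2 * k))).Adj u v ↔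
      (min u.val (2 * k) + 1 = min v.val (2 * k) ∨ min v.val (2 * k) + 1 = min u.val (2 * k)) := by
    intro u v
    rw [commGraph_adj]
    simp only [broomPath, ne_eq, Fin.ext_iff]
    omega
  refine ⟨broomPath n (2 * k), ⟨fun v => ?_, fun u v h => Or.symm h⟩,
    connected_of_exists_lt (by omega) _ fun v hv => ?_,
    .of_min id (fun i => (⟨2 * i.val + 1, by omega⟩ : Fin n)) ?_,
    1, vertexBit 1, ?_⟩
  · simp [broomPath]
  · refine ⟨⟨min v.val (2 * k) - 1, by omega⟩, by simp only; omega, ?_⟩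
    rw [hadj]
    simp only
    omega
  · intro u v huv
    rw [hadj] at huv
    have key : ∀ w : Fin n, w.val % 2 = 1 → w.val < 2 * k →
        w ∈ Set.range (fun i : Fin k => (⟨2 * i.val + 1, by omega⟩ : Fin n)) := by
      intro w h1 h2
      exact ⟨⟨w.val / 2, by omega⟩, Fin.ext (by simp only; omega)⟩
    by_cases h : u.val % 2 = 1 ∧ u.val < 2 * k
    · exact Or.inl (key u h.1 h.2)
    · exact Or.inr (key v (by omega) (by omega))
  · constructor
    · exact Or.inl rfl
    · omega
    · intro u v
      simp only [broomPath]
      omega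
    · intro u v u' v'
      simp only [broomPath]
      omega
    · intro id₁ id₂ _ _ S₁ S₂ i j u w _ _ _ _ hu hw h _
      exact vertexBit_congr S₁ S₂ i j u w hu hw h
    · intro (S : Set (Fin n)) b hS _ hmin F hF
      have hb : ∀ i, (∃ s ∈ S, 2 * s.val = 2 * i) ↔ vertexBit 1 S i := by
        intro i
        simp only [vertexBit]
        refine exists_congr fun s => and_congr_right fun _ => ?_
        omega
      have h := two_mul_add_card_le_ncard (α := Fin n) S (fun v => 2 * v.val) k
        (fun i hi => by
          rcases hS ((hadj ⟨i, by omega⟩ ⟨i + 1, by omega⟩).2 (by simp only; omega)) with h | h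
          · exact ⟨_, h, Or.inl rfl⟩
          · exact ⟨_, h, Or.inr (Or.inr (by simp only; omega))⟩)
        F (fun i hi => by
          obtain ⟨h1, h2, h3⟩ := hF i hi
          exact ⟨by omega, (hb _).trans (h3.trans (hb _).symm)⟩)
      have := hmin id
      simp only [Problem.Item] at *
      omega

/-- The padding has to be a clique here: it contributes at most one vertex and so acts as the last
of the `2 * k - 1` vertices of a path. -/
theorem hasChain_MaxIS {k n : ℕ} (hk : 10 ≤ k) (hn : 4 * k + 10 ≤ n) :
    Problem.MaxIS.HasChain k n := by
  have hadj : ∀ u v : Fin n, (commGraph (cliquePath n (2 * k - 2))).Adj u v ↔ u.val ≠ v.val ∧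
      min u.val (2 * k - 2) ≤ min v.val (2 * k - 2) + 1 ∧
      min v.val (2 * k - 2) ≤ min u.val (2 * k - 2) + 1 := by
    intro u v
    rw [commGraph_adj]
    simp only [cliquePath, ne_eq, Fin.ext_iff]
    omega
  refine ⟨cliquePath n (2 * k - 2), ⟨fun v => ?_, fun u v h => ⟨h.1.symm, h.2.2, h.2.1⟩⟩,
    connected_of_exists_lt (by omega) _ fun v hv => ?_,
    Problem.HasSolution.of_max (P := .MaxIS) trivial (fun i => (⟨2 * i.val, by omega⟩ : Fin n)) ?_ ?_,
    1, vertexBit 1, ?_⟩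
  · simp [cliquePath]
  · refine ⟨⟨min v.val (2 * k - 2) - 1, by omega⟩, by simp only; omega, ?_⟩
    rw [hadj]
    simp only
    omega
  · rintro _ ⟨i, rfl⟩ _ ⟨j, rfl⟩ hij
    rw [hadj]
    rw [ne_eq, Fin.ext_iff] at hij
    simp only at hij ⊢
    omega
  · intro i j hij
    have := Fin.ext_iff.1 hij
    simp only at this
    exact Fin.ext (by omega)
  · constructor
    · exact Or.inl rfl
    · omega
    · intro u v
      simp only [cliquePath]
      omega
    · intro u v u' v'
      simp only [cliquePath, ne_eq, Fin.ext_iff]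
      omega
    · intro id₁ id₂ _ _ S₁ S₂ i j u w _ _ _ _ hu hw h _
      exact vertexBit_congr S₁ S₂ i j u w hu hw h
    · intro (S : Set (Fin n)) b hS hmax _ F hF
      have hS' : ∀ u ∈ S, ∀ v ∈ S, u.val ≠ v.val →
          ¬ (min u.val (2 * k - 2) ≤ min v.val (2 * k - 2) + 1 ∧
            min v.val (2 * k - 2) ≤ min u.val (2 * k - 2) + 1) := by
        intro u hu v hv huv hc
        exact hS hu hv (fun h => huv (congrArg Fin.val h)) ((hadj u v).2 ⟨huv, hc⟩)
      have hb : ∀ i, i + 5 ≤ 2 * k →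
          ((∃ s ∈ S, min s.val (2 * k - 2) = i) ↔ vertexBit 1 S i) := by
        intro i hi
        simp only [vertexBit]
        refine exists_congr fun s => and_congr_right fun _ => ?_
        omega
      have h := two_mul_ncard_add_card_le (α := Fin n) S (fun v => min v.val (2 * k - 2)) k
        (by omega)
        (fun u hu v hv (huv : min u.val (2 * k - 2) = min v.val (2 * k - 2)) => by
          by_contra hne
          refine hS' u hu v hv (fun h => hne (Fin.ext h)) ?_
          omega)
        (fun u hu => by omega)
        (fun u hu v hv huv => by
          exact hS' u hu v hv (fun h => by rw [h] at huv; omega) (by omega))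
        F (fun i hi => by
          obtain ⟨h1, h2, h3⟩ := hF i hi
          exact ⟨by omega, (hb _ (by omega)).trans (h3.trans (hb _ (by omega)).symm)⟩)
      have := hmax trivial
      simp only [Problem.Item] at *
      omega

/-- With an edge numbered by its smaller endpoint, a matching becomes a set of numbers below `2 * k
- 1` without consecutive elements. The padding edges all contain `2 * k - 2`, so a matching uses at
most one of them. -/
theorem hasChain_MaxM {k n : ℕ} (hk : 10 ≤ k) (hn : 4 * k + 10 ≤ n) :
    Problem.MaxM.HasChain k n := by
  have hadj : ∀ u v : Fin n, (commGraph (broomPath n (2 * k - 1))).Adj u v ↔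
      (min u.val (2 * k - 1) + 1 = min v.val (2 * k - 1) ∨
        min v.val (2 * k - 1) + 1 = min u.val (2 * k - 1)) := by
    intro u v
    rw [commGraph_adj]
    simp only [broomPath, ne_eq, Fin.ext_iff]
    omega
  refine ⟨broomPath n (2 * k - 1), ⟨fun v => ?_, fun u v h => Or.symm h⟩,
    connected_of_exists_lt (by omega) _ fun v hv => ?_,
    Problem.HasSolution.of_max (P := .MaxM) trivial
      (fun i => s((⟨2 * i.val, by omega⟩ : Fin n), (⟨2 * i.val + 1, by omega⟩ : Fin n)))
      ⟨?_, ?_⟩ ?_,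
    1, edgeBit (fun i => i + 1) (fun i => i), ?_⟩
  · simp [broomPath]
  · refine ⟨⟨min v.val (2 * k - 1) - 1, by omega⟩, by simp only; omega, ?_⟩
    rw [hadj]
    simp only
    omega
  · rintro _ ⟨i, rfl⟩
    rw [SimpleGraph.mem_edgeSet, hadj]
    simp only
    omega
  · rintro _ ⟨i, rfl⟩ _ ⟨j, rfl⟩ hij v hv hv'
    simp only [Sym2.mem_iff, Fin.ext_iff] at hv hv'
    have : i = j := Fin.ext (by omega)
    exact hij (by rw [this])
  · intro i j hij
    have := congrArg (fun e : Sym2 (Fin n) => e.inf.val) hij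
    simp only [Sym2.inf_mk, Fin.coe_min] at this
    exact Fin.ext (by omega)
  · constructor
    · exact Or.inl rfl
    · omega
    · intro u v
      simp only [broomPath]
      omega
    · intro u v u' v'
      simp only [broomPath]
      omega
    · intro id₁ id₂ h₁ h₂ S₁ S₂ i j u w _ _ _ _ hu hw h hid
      refine edgeBit_congr h₁ h₂ S₁ S₂ i j u w ⟨i + 1, by omega⟩ ⟨j + 1, by omega⟩
        (by omega) (by omega) rfl rfl (hid _ _ (by omega) (by omega) (by omega))
        (hid _ _ (by simp only; omega) (by simp only; omega) (by simp only; omega)) h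
    · intro (S : Set (Sym2 (Fin n))) b hS hmax _ F hF
      have hS₁ : ∀ u v : Fin n, s(u, v) ∈ S → (min u.val (2 * k - 1) + 1 = min v.val (2 * k - 1) ∨
          min v.val (2 * k - 1) + 1 = min u.val (2 * k - 1)) := by
        intro u v h
        exact (hadj u v).1 (hS.1 h)
      have hS₂ : ∀ e ∈ S, ∀ e' ∈ S, ∀ v, v ∈ e → v ∈ e' → e = e' := by
        intro e he e' he' v hv hv'
        by_contra hne
        exact hS.2 e he e' he' hne v hv hv'
      have hb : ∀ i, i + 5 ≤ 2 * k →
          ((∃ e ∈ S, e.inf.val = i) ↔ edgeBit (fun i => i + 1) (fun i => i) S i) := by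
        intro i hi
        constructor
        · rintro ⟨e, he, hei⟩
          induction e with
          | _ u v =>
            have := hS₁ u v he
            simp only [Sym2.inf_mk, Fin.coe_min] at hei
            rcases le_total u.val v.val with huv | huv
            · exact ⟨v, u, by simp only; omega, by simp only; omega, by rwa [Sym2.eq_swap]⟩
            · exact ⟨u, v, by simp only; omega, by simp only; omega, he⟩
        · rintro ⟨x, u, hx, hu, he⟩
          refine ⟨_, he, ?_⟩
          simp only at hx hu
          simp only [Sym2.inf_mk, Fin.coe_min]
          omega
      have hmin : ∀ e : Sym2 (Fin n), e ∈ S → ∃ u v : Fin n, e = s(u, v) ∧ e.inf.val = u.val ∧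
          u.val < 2 * k - 1 ∧ min v.val (2 * k - 1) = u.val + 1 := by
        intro e he
        induction e with
        | _ u v =>
          have := hS₁ u v he
          rcases le_total u.val v.val with huv | huv
          · refine ⟨u, v, rfl, ?_, by omega, by omega⟩
            simp only [Sym2.inf_mk, Fin.coe_min]
            omega
          · refine ⟨v, u, Sym2.eq_swap, ?_, by omega, by omega⟩
            simp only [Sym2.inf_mk, Fin.coe_min]
            omega
      have h := two_mul_ncard_add_card_le S (fun e => e.inf.val) k (by omega)
        (fun e he e' he' (hee : e.inf.val = e'.inf.val) =>
          hS₂ e he e' he' e.inf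
            (by
              obtain ⟨u, v, rfl, h1, -⟩ := hmin e he
              rw [(Fin.ext h1 : s(u, v).inf = u)]
              exact Sym2.mem_mk_left u v)
            (by
              obtain ⟨u, v, rfl, h1, -⟩ := hmin e' he'
              rw [Fin.ext hee, (Fin.ext h1 : s(u, v).inf = u)]
              exact Sym2.mem_mk_left u v))
        (fun e he => by
          obtain ⟨u, v, rfl, h1, h2, -⟩ := hmin e he
          rw [h1]
          exact h2)
        (fun e he e' he' (hee : e'.inf.val = e.inf.val + 1) => by
          obtain ⟨u, v, rfl, h1, h2, h3⟩ := hmin e he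
          obtain ⟨u', v', rfl, h1', h2', h3'⟩ := hmin e' he'
          have huv : u' = v := Fin.ext (by omega)
          have := hS₂ _ he _ he' v (Sym2.mem_mk_right _ _) (huv ▸ Sym2.mem_mk_left _ _)
          rw [this] at hee
          omega)
        F (fun i hi => by
          obtain ⟨h1, h2, h3⟩ := hF i hi
          exact ⟨by omega, (hb _ (by omega)).trans (h3.trans (hb _ (by omega)).symm)⟩)
      have := hmax trivial
      simp only [Problem.Item] at *
      omega

/-! ### Triangle strip: dominating set, feedback vertex set -/

theorem triangleStrip_adj {n k : ℕ} (u v : Fin n) :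
    (commGraph (triangleStrip n k)).Adj u v ↔ (triangleStrip n k).Adj u v := by
  rw [commGraph_adj]
  simp only [triangleStrip, ne_eq, Fin.ext_iff]
  omega

theorem triangleStrip_connected {n k : ℕ} (hk : 10 ≤ k) (hn : 4 * k + 10 ≤ n) :
    (commGraph (triangleStrip n k)).Connected := by
  refine connected_of_exists_lt (by omega) _ fun v hv => ?_
  simp only [triangleStrip_adj]
  by_cases h : v.val ≤ 4 * k
  · refine ⟨⟨v.val - 1, by omega⟩, by simp only; omega, ?_⟩
    simp only [triangleStrip]
    omega
  · refine ⟨⟨4 * k - 2, by omega⟩, by simp only; omega, ?_⟩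
    simp only [triangleStrip]
    omega

/-- Both problems force a solution to hit every triangle: a feedback vertex set because it is a
cycle, a dominating set because the closed neighbourhood of `2 * i + 1` is triangle `i`. -/
theorem triangleStrip_rigid {n k : ℕ} (S : Set (Fin n)) (b : ℕ)
    (hS : ∀ i < 2 * k, ∃ s ∈ S, s.val = 2 * i ∨ s.val = 2 * i + 1 ∨ s.val = 2 * i + 2)
    (hmin : S.ncard ≤ k + b) (F : Finset ℕ)
    (hF : ∀ i ∈ F, 4 ≤ i ∧ i + 10 ≤ 2 * k ∧ (vertexBit 2 S i ↔ vertexBit 2 S (i + 1))) :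
    F.card ≤ 2 * b := by
  have h := two_mul_add_card_le_ncard S (fun v => v.val) k hS F fun i hi => by
    obtain ⟨h1, h2, h3⟩ := hF i hi
    exact ⟨by omega, h3⟩
  omega

theorem isChain_triangleStrip {P : Problem} {n k : ℕ} (hn : 4 * k + 10 ≤ n)
    (bit : Set (P.Item (Fin n)) → ℕ → Prop)
    (hbit : ∀ (id₁ id₂ : Fin n → ℕ) (S₁ S₂ : Set (P.Item (Fin n))) (i j : ℕ) (u w : Fin n),
      u.val = 2 * i → w.val = 2 * j → P.label id₁ S₁ u = P.label id₂ S₂ w →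
      (bit S₁ i ↔ bit S₂ j))
    (hrigid : ∀ (S : Set (P.Item (Fin n))) (b : ℕ), P.Feasible (triangleStrip n k) S →
      (P.IsMax → k ≤ S.ncard + b) → (¬ P.IsMax → S.ncard ≤ k + b) → ∀ F : Finset ℕ,
      (∀ i ∈ F, 4 ≤ i ∧ i + 10 ≤ 2 * k ∧ (bit S i ↔ bit S (i + 1))) → F.card ≤ 2 * b) :
    IsChain P k n 2 (triangleStrip n k) bit where
  step := Or.inr rfl
  card := by omega
  near u v := by
    simp only [triangleStrip]
    omega
  shift u v u' v' := by
    simp only [triangleStrip]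
    omega
  bit_congr id₁ id₂ _ _ S₁ S₂ i j u w _ _ _ _ hu hw h _ :=
    hbit id₁ id₂ S₁ S₂ i j u w hu hw h
  rigid := hrigid

theorem mem_range_four_mul_add_two {n k : ℕ} (hn : 4 * k + 10 ≤ n) (v : Fin n) :
    v ∈ Set.range (fun i : Fin k => (⟨4 * i.val + 2, by omega⟩ : Fin n)) ↔
      v.val % 4 = 2 ∧ v.val < 4 * k := by
  constructor
  · rintro ⟨i, rfl⟩
    simp only
    omega
  · rintro ⟨h1, h2⟩
    exact ⟨⟨v.val / 4, by omega⟩, Fin.ext (by simp only; omega)⟩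

/-- Vertex `4 * i + 2` dominates everything from `4 * i` to `4 * i + 4`, and the last of these
vertices also dominates the padding. -/
theorem hasChain_MDS {k n : ℕ} (hk : 10 ≤ k) (hn : 4 * k + 10 ≤ n) :
    Problem.MDS.HasChain k n := by
  refine ⟨triangleStrip n k, ⟨fun v => ?_, fun u v h => Or.symm h⟩, triangleStrip_connected hk hn,
    .of_min id (fun i => (⟨4 * i.val + 2, by omega⟩ : Fin n)) ?_, 2, vertexBit 2,
    isChain_triangleStrip hn _ ?_ ?_⟩
  · simp only [triangleStrip]
    omega
  · intro v
    have key : ∀ m : ℕ, m % 4 = 2 → m < 4 * k → ∀ hm : m < n,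
        (triangleStrip n k).Adj ⟨m, hm⟩ v →
        ∃ u ∈ Set.range (fun i : Fin k => (⟨4 * i.val + 2, by omega⟩ : Fin n)),
          (commGraph (triangleStrip n k)).Adj u v := by
      intro m h1 h2 hm h
      exact ⟨⟨m, hm⟩, (mem_range_four_mul_add_two hn _).2 ⟨h1, h2⟩, (triangleStrip_adj _ _).2 h⟩
    by_cases h0 : v.val % 4 = 2 ∧ v.val < 4 * k
    · exact Or.inl ((mem_range_four_mul_add_two hn v).2 h0)
    right
    by_cases h1 : 4 * k ≤ v.val
    · exact key (4 * k - 2) (by omega) (by omega) (by omega)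
        (by simp only [triangleStrip]; omega)
    by_cases h2 : v.val % 4 = 3
    · exact key (v.val - 1) (by omega) (by omega) (by omega)
        (by simp only [triangleStrip]; omega)
    by_cases h3 : v.val % 4 = 1
    · exact key (v.val + 1) (by omega) (by omega) (by omega)
        (by simp only [triangleStrip, and_true, true_or]; omega)
    · exact key (v.val + 2) (by omega) (by omega) (by omega)
        (by simp only [triangleStrip, and_true]; omega)
  · intro id₁ id₂ S₁ S₂ i j u w hu hw h
    exact vertexBit_congr S₁ S₂ i j u w hu hw h
  · intro (S : Set (Fin n)) b hS _ hmin F hF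
    refine triangleStrip_rigid S b (fun i hi => ?_) (hmin id) F hF
    rcases hS ⟨2 * i + 1, by omega⟩ with h | ⟨u, hu, h⟩
    · exact ⟨_, h, Or.inr (Or.inl rfl)⟩
    · refine ⟨u, hu, ?_⟩
      rw [triangleStrip_adj] at h
      simp only [triangleStrip] at h
      omega

/-- A graph in which every edge has an endpoint of degree one is acyclic. -/
theorem isAcyclic_of_forall_adj_leaf {V : Type*} (G : SimpleGraph V) (L : V → Prop)
    (hL : ∀ u, L u → ∀ v w, G.Adj u v → G.Adj u w → v = w)
    (hG : ∀ u v, G.Adj u v → L u ∨ L v) : G.IsAcyclic := by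
  have key : ∀ u v, L u → G.Adj u v → ¬ (G.deleteEdges {s(u, v)}).Reachable u v := by
    rintro u v hu huv ⟨p⟩
    cases p with
    | nil => exact G.loopless.irrefl _ huv
    | cons h _ =>
      rw [SimpleGraph.deleteEdges_adj] at h
      exact h.2 (by rw [hL u hu _ _ h.1 huv]; rfl)
  rw [SimpleGraph.isAcyclic_iff_forall_adj_isBridge]
  intro u v huv
  rcases hG u v huv with hu | hv
  · exact SimpleGraph.isBridge_iff.2 (key u v hu huv)
  · rw [Sym2.eq_swap]
    exact SimpleGraph.isBridge_iff.2 (key v u hv huv.symm)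

theorem hasChain_MFVS {k n : ℕ} (hk : 10 ≤ k) (hn : 4 * k + 10 ≤ n) :
    Problem.MFVS.HasChain k n := by
  refine ⟨triangleStrip n k, ⟨fun v => ?_, fun u v h => Or.symm h⟩, triangleStrip_connected hk hn,
    .of_min id (fun i => (⟨4 * i.val + 2, by omega⟩ : Fin n)) ?_, 2, vertexBit 2,
    isChain_triangleStrip hn _ ?_ ?_⟩
  · simp only [triangleStrip]
    omega
  -- Once the vertices `4 * i + 2` are gone, an odd number keeps at most one neighbour, a multiple
  -- of four, and no edge joins two even numbers.
  · refine isAcyclic_of_forall_adj_leaf _ (fun u => u.1.val % 2 = 1) ?_ ?_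
    · rintro ⟨u, hu⟩ h0 ⟨v, hv⟩ ⟨w, hw⟩ huv huw
      rw [SimpleGraph.induce_adj, triangleStrip_adj] at huv huw
      have hu' := mt (mem_range_four_mul_add_two hn u).2 hu
      have hv' := mt (mem_range_four_mul_add_two hn v).2 hv
      have hw' := mt (mem_range_four_mul_add_two hn w).2 hw
      simp only [triangleStrip] at h0 huv huw
      exact Subtype.ext (Fin.ext (by simp only; omega))
    · rintro ⟨u, hu⟩ ⟨v, hv⟩ huv
      rw [SimpleGraph.induce_adj, triangleStrip_adj] at huv
      have hu' := mt (mem_range_four_mul_add_two hn u).2 hu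
      have hv' := mt (mem_range_four_mul_add_two hn v).2 hv
      simp only [triangleStrip] at huv ⊢
      omega
  · intro id₁ id₂ S₁ S₂ i j u w hu hw h
    exact vertexBit_congr S₁ S₂ i j u w hu hw h
  · intro (S : Set (Fin n)) b hS _ hmin F hF
    refine triangleStrip_rigid S b (fun i hi => ?_) (hmin id) F hF
    by_contra hc
    have hnot : ∀ d ≤ 2, ∀ hd : 2 * i + d < n, (⟨2 * i + d, hd⟩ : Fin n) ∈ Sᶜ := by
      intro d hd hd' hmem
      exact hc ⟨_, hmem, by simp only; omega⟩
    have hfree : ((commGraph (triangleStrip n k)).induce Sᶜ).CliqueFree 3 :=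
      SimpleGraph.IsAcyclic.cliqueFree hS le_rfl
    refine hfree {⟨_, hnot 0 (by omega) (by omega)⟩, ⟨_, hnot 1 (by omega) (by omega)⟩,
      ⟨_, hnot 2 (by omega) (by omega)⟩} (SimpleGraph.is3Clique_triple_iff.2 ⟨?_, ?_, ?_⟩) <;>
    · rw [SimpleGraph.induce_adj, triangleStrip_adj]
      simp only [triangleStrip, and_true, true_or]
      omega

/-! ### Comb: edge dominating set -/

/-- Dominating the pendant edge `2 * i, 2 * i + 1` takes an edge at `2 * i`, and its larger endpoint
is `2 * i`, `2 * i + 1` or `2 * i + 2`, up to padding. So numbering edges by larger endpoints gives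
the triples. -/
theorem hasChain_MEDS {k n : ℕ} (hk : 10 ≤ k) (hn : 4 * k + 10 ≤ n) :
    Problem.MEDS.HasChain k n := by
  have hadj : ∀ u v : Fin n, (commGraph (comb n k)).Adj u v ↔ (comb n k).Adj u v := by
    intro u v
    rw [commGraph_adj]
    simp only [comb, ne_eq, Fin.ext_iff]
    omega
  refine ⟨comb n k, ⟨fun v => ?_, fun u v h => Or.symm h⟩,
    connected_of_exists_lt (by omega) _ fun v hv => ?_,
    Problem.HasSolution.of_min (P := .MEDS) id
      (fun i => s((⟨4 * i.val, by omega⟩ : Fin n), (⟨4 * i.val + 2, by omega⟩ : Fin n)))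
      ⟨?_, ?_⟩,
    2, edgeBit (fun i => 2 * i - 2) (fun i => 2 * i), ?_⟩
  · simp only [comb]
    omega
  · simp only [hadj]
    by_cases h1 : 4 * k ≤ v.val
    · refine ⟨⟨4 * k - 2, by omega⟩, by simp only; omega, ?_⟩
      simp only [comb]
      omega
    by_cases h2 : v.val % 2 = 1
    · refine ⟨⟨v.val - 1, by omega⟩, by simp only; omega, ?_⟩
      simp only [comb]
      omega
    · refine ⟨⟨v.val - 2, by omega⟩, by simp only; omega, ?_⟩
      simp only [comb]
      omega
  · rintro _ ⟨i, rfl⟩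
    rw [SimpleGraph.mem_edgeSet, hadj]
    simp only [comb, and_true, or_true]
    omega
  · intro e he
    have key : ∀ v : Fin n, v.val % 2 = 0 → v.val < 4 * k →
        ∃ e' ∈ Set.range (fun i : Fin k =>
          s((⟨4 * i.val, by omega⟩ : Fin n), (⟨4 * i.val + 2, by omega⟩ : Fin n))), v ∈ e' := by
      intro v h1 h2
      refine ⟨_, ⟨⟨v.val / 4, by omega⟩, rfl⟩, ?_⟩
      simp only [Sym2.mem_iff, Fin.ext_iff]
      omega
    induction e with
    | _ u v =>
      rw [SimpleGraph.mem_edgeSet, hadj] at he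
      simp only [comb] at he
      by_cases h : u.val % 2 = 0 ∧ u.val < 4 * k
      · obtain ⟨e', he', h'⟩ := key u h.1 h.2
        exact ⟨e', he', u, Sym2.mem_mk_left _ _, h'⟩
      · obtain ⟨e', he', h'⟩ := key v (by omega) (by omega)
        exact ⟨e', he', v, Sym2.mem_mk_right _ _, h'⟩
  · constructor
    · exact Or.inr rfl
    · omega
    · intro u v
      simp only [comb]
      omega
    · intro u v u' v'
      simp only [comb]
      omega
    · intro id₁ id₂ h₁ h₂ S₁ S₂ i j u w _ _ _ _ hu hw h hid
      refine edgeBit_congr h₁ h₂ S₁ S₂ i j u w ⟨2 * i - 2, by omega⟩ ⟨2 * j - 2, by omega⟩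
        (by omega) (by omega) rfl rfl (hid _ _ (by omega) (by omega) (by omega))
        (hid _ _ (by simp only; omega) (by simp only; omega) (by simp only; omega)) h
    · intro (S : Set (Sym2 (Fin n))) b hS _ hmin F hF
      have hS₁ : ∀ u v : Fin n, s(u, v) ∈ S → (comb n k).Adj u v := by
        intro u v h
        exact (hadj u v).1 (hS.1 h)
      have hb : ∀ i, 4 ≤ i → i + 5 ≤ 2 * k → ((∃ e ∈ S, min e.sup.val (4 * k) = 2 * i) ↔
          edgeBit (fun i => 2 * i - 2) (fun i => 2 * i) S i) := by
        intro i hi hi'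
        constructor
        · rintro ⟨e, he, hei⟩
          induction e with
          | _ u v =>
            have := hS₁ u v he
            simp only [comb] at this
            simp only [Sym2.sup_mk, Fin.coe_max] at hei
            rcases le_total u.val v.val with huv | huv
            · exact ⟨u, v, by simp only; omega, by simp only; omega, he⟩
            · exact ⟨v, u, by simp only; omega, by simp only; omega, by rwa [Sym2.eq_swap]⟩
        · rintro ⟨x, u, hx, hu, he⟩
          refine ⟨_, he, ?_⟩
          simp only at hx hu
          simp only [Sym2.sup_mk, Fin.coe_max]
          omega
      -- Capping at `4 * k` sends the padding edges at `4 * k - 2` to the end of the last triple.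
      have h := two_mul_add_card_le_ncard S (fun e => min e.sup.val (4 * k)) k
        (fun i hi => by
          have hmem : s((⟨2 * i, by omega⟩ : Fin n), (⟨2 * i + 1, by omega⟩ : Fin n)) ∈
              (commGraph (comb n k)).edgeSet := by
            rw [SimpleGraph.mem_edgeSet, hadj]
            simp only [comb, and_true, true_or]
            omega
          obtain ⟨e, he, v, hv, hve⟩ := hS.2 _ hmem
          obtain ⟨w, rfl⟩ := Sym2.mem_iff_exists.1 hve
          refine ⟨_, he, ?_⟩
          have := hS₁ v w he
          simp only [comb] at this
          simp only [Sym2.mem_iff, Fin.ext_iff] at hv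
          simp only [Sym2.sup_mk, Fin.coe_max]
          omega)
        F (fun i hi => by
          obtain ⟨h1, h2, h3⟩ := hF i hi
          exact ⟨by omega, (hb _ (by omega) (by omega)).trans
            (h3.trans (hb _ (by omega) (by omega)).symm)⟩)
      have := hmin id
      simp only [Problem.Item] at *
      omega

/-! ### Chain of directed cycles: feedback edge set -/

theorem arcBit_congr {n : ℕ} {id₁ id₂ : Fin n → ℕ} (h₁ : Function.Injective id₁)
    (h₂ : Function.Injective id₂) (Y₁ Y₂ : Set (Fin n × Fin n)) (i j : ℕ) (u w x y : Fin n)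
    (hu : u.val = 2 * i) (hw : w.val = 2 * j) (hx : x.val = 2 * i + 1) (hy : y.val = 2 * j + 1)
    (huw : id₁ u = id₂ w) (hxy : id₁ x = id₂ y)
    (h : {f | ∃ a ∈ Y₁, (u = a.1 ∨ u = a.2) ∧ f = (id₁ a.1, id₁ a.2)} =
      {f | ∃ a ∈ Y₂, (w = a.1 ∨ w = a.2) ∧ f = (id₂ a.1, id₂ a.2)}) :
    arcBit Y₁ i ↔ arcBit Y₂ j := by
  have key : ∀ (ident : Fin n → ℕ), Function.Injective ident → ∀ (Y : Set (Fin n × Fin n))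
      (i : ℕ) (u x : Fin n), u.val = 2 * i → x.val = 2 * i + 1 →
      (arcBit Y i ↔
        (ident u, ident x) ∈ {f | ∃ a ∈ Y, (u = a.1 ∨ u = a.2) ∧ f = (ident a.1, ident a.2)}) := by
    intro ident hident Y i u x hu hx
    constructor
    · rintro ⟨u', x', hu', hx', he⟩
      rw [(Fin.ext (hx'.trans hx.symm) : x' = x), (Fin.ext (hu'.trans hu.symm) : u' = u)] at he
      exact ⟨_, he, Or.inl rfl, rfl⟩
    · rintro ⟨⟨a, c⟩, ha, -, he⟩
      simp only [Prod.mk.injEq] at he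
      rw [← hident he.1, ← hident he.2] at ha
      exact ⟨u, x, hu, hx, ha⟩
  rw [key id₁ h₁ Y₁ i u x hu hx, key id₂ h₂ Y₂ j w y hw hy, h, huw, hxy]

theorem hasChain_MFES {k n : ℕ} (hk : 10 ≤ k) (hn : 4 * k + 10 ≤ n) :
    Problem.MFES.HasChain k n := by
  refine ⟨cycleChain n k, ⟨fun v => ?_, trivial⟩,
    connected_of_exists_lt (by omega) _ fun v hv => ?_,
    Problem.HasSolution.of_min (P := .MFES) id
      (fun i => ((⟨4 * i.val + 2, by omega⟩ : Fin n), (⟨4 * i.val + 3, by omega⟩ : Fin n)))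
      ⟨?_, ?_⟩,
    2, arcBit, ?_⟩
  · simp only [cycleChain]
    omega
  · simp only [commGraph_adj]
    by_cases h1 : v.val ≤ 4 * k
    · refine ⟨⟨v.val - 1, by omega⟩, by simp only; omega, ?_⟩
      simp only [cycleChain, ne_eq, Fin.ext_iff]
      omega
    · refine ⟨⟨4 * k, by omega⟩, by simp only; omega, ?_⟩
      simp only [cycleChain, true_and, ne_eq, Fin.ext_iff]
      omega
  · rintro _ ⟨i, rfl⟩
    simp only [cycleChain, and_true]
    omega
  -- A potential that increases along every remaining arc: the deleted arcs `4 * i + 2 → 4 * i + 3`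
  -- are those on which it drops from `3` to `0`.
  · have key : ∀ a c : Fin n, Relation.TransGen (fun a c => (cycleChain n k).Adj a c ∧
        (a, c) ∉ Set.range (fun i : Fin k =>
          ((⟨4 * i.val + 2, by omega⟩ : Fin n), (⟨4 * i.val + 3, by omega⟩ : Fin n)))) a c →
        (if a.val ≤ 4 * k + 1 then (a.val + 1) % 4 else 3) <
          (if c.val ≤ 4 * k + 1 then (c.val + 1) % 4 else 3) := by
      intro a c h
      refine Relation.TransGen.trans_induction_on h ?_ (fun _ _ h1 h2 => h1.trans h2)
      rintro a c ⟨h1, h2⟩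
      have h3 : ¬ (a.val % 4 = 2 ∧ a.val < 4 * k ∧ c.val = a.val + 1) := by
        rintro ⟨e1, e2, e3⟩
        exact h2 ⟨⟨a.val / 4, by omega⟩, Prod.ext (Fin.ext (by simp only; omega))
          (Fin.ext (by simp only; omega))⟩
      simp only [cycleChain] at h1
      split_ifs <;> omega
    exact fun v h => lt_irrefl _ (key v v h)
  · constructor
    · exact Or.inr rfl
    · omega
    · intro u v
      simp only [cycleChain]
      omega
    · intro u v u' v'
      simp only [cycleChain]
      omega
    · intro id₁ id₂ h₁ h₂ S₁ S₂ i j u w _ _ _ _ hu hw h hid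
      refine arcBit_congr h₁ h₂ S₁ S₂ i j u w ⟨2 * i + 1, by omega⟩ ⟨2 * j + 1, by omega⟩
        (by omega) (by omega) rfl rfl (hid _ _ (by omega) (by omega) (by omega))
        (hid _ _ (by simp only; omega) (by simp only; omega) (by simp only; omega)) h
    · intro (S : Set (Fin n × Fin n)) b hS _ hmin F hF
      -- Consecutive cycles share the arc leaving an even number, which is numbered by its tail. The
      -- two arcs private to cycle `i` both get `2 * i + 1`, so cycle `i` is triple `i`.
      let π : Fin n × Fin n → ℕ := fun a => if a.1.val % 2 = 0 then a.1.val else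
        if a.2.val = a.1.val + 1 then a.1.val else a.2.val + 1
      have hadj : ∀ a ∈ S, (cycleChain n k).Adj a.1 a.2 := hS.1
      have hb : ∀ i, 4 ≤ i → i + 5 ≤ 2 * k → ((∃ a ∈ S, π a = 2 * i) ↔ arcBit S i) := by
        intro i hi hi'
        constructor
        · rintro ⟨⟨u, v⟩, he, hei⟩
          have := hadj _ he
          simp only [cycleChain] at this
          simp only [π] at hei
          refine ⟨u, v, ?_, ?_, he⟩ <;> split_ifs at hei <;> omega
        · rintro ⟨x, u, hx, hu, he⟩
          refine ⟨_, he, ?_⟩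
          simp only [π]
          split_ifs <;> omega
      have h := two_mul_add_card_le_ncard S π k
        (fun i hi => by
          by_contra hc
          have hedge : ∀ a c : Fin n, (cycleChain n k).Adj a c →
              (π (a, c) = 2 * i ∨ π (a, c) = 2 * i + 1 ∨ π (a, c) = 2 * i + 2) →
              Relation.TransGen (fun a c => (cycleChain n k).Adj a c ∧ (a, c) ∉ S) a c :=
            fun a c h1 h2 => .single ⟨h1, fun h => hc ⟨_, h, h2⟩⟩
          have e1 := hedge ⟨2 * i, by omega⟩ ⟨2 * i + 1, by omega⟩
            (by simp only [cycleChain, and_true]; omega) (by simp only [π]; split_ifs <;> omega)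
          have e2 := hedge ⟨2 * i + 1, by omega⟩ ⟨2 * i + 2, by omega⟩
            (by simp only [cycleChain, and_true]; omega) (by simp only [π]; split_ifs <;> omega)
          have e3 := hedge ⟨2 * i + 2, by omega⟩ ⟨2 * i + 3, by omega⟩
            (by simp only [cycleChain, and_true]; omega) (by simp only [π]; split_ifs <;> omega)
          have e4 := hedge ⟨2 * i + 3, by omega⟩ ⟨2 * i, by omega⟩
            (by simp only [cycleChain, and_true]; omega) (by simp only [π]; split_ifs <;> omega)
          exact hS.2 _ (((e1.trans e2).trans e3).trans e4))
        F (fun i hi => by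
          obtain ⟨h1, h2, h3⟩ := hF i hi
          exact ⟨by omega, (hb _ (by omega) (by omega)).trans
            (h3.trans (hb _ (by omega) (by omega)).symm)⟩)
      have := hmin id
      simp only [Problem.Item] at *
      omega

/-! ### Assembling the bounds -/

theorem Problem.hasChain (P : Problem) {k n : ℕ} (hk : 10 ≤ k) (hn : 4 * k + 10 ≤ n) :
    P.HasChain k n := by
  cases P
  · exact hasChain_MVC hk hn
  · exact hasChain_MaxM hk hn
  · exact hasChain_MaxIS hk hn
  · exact hasChain_MDS hk hn
  · exact hasChain_MEDS hk hn
  · exact hasChain_MFVS hk hn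
  · exact hasChain_MFES hk hn

end ParamLocal

open ParamLocal
theorem mainTheorem9 (P : Problem) :
    -- `(1 + ε)`-approximation
    (∃ ε₀ : ℝ, 0 < ε₀ ∧ ∀ C : ℝ, 0 < C → ∃ c : ℝ, 0 < c ∧ ∃ k₀ : ℕ, ∀ k : ℕ, k₀ ≤ k →
      ∀ ε : ℝ, C / k ≤ ε → ε ≤ ε₀ → ∀ δ : ℝ, δ < 1 / 2 → ∀ N : ℕ,
        ∃ n : ℕ, N ≤ n ∧ ∃ D : Digraph (Fin n),
          P.IsInstance D ∧ (commGraph D).Connected ∧ P.HasSolution D k ∧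
          ∀ I : Finset ℕ, I.card = n → ∀ (A : RandLocalAlg (Option P.Label)) (T : ℕ),
            A.SolvesOn D I T k (1 + ε) δ → c / ε ≤ T) ∧
    -- exact computation
    (∃ c : ℝ, 0 < c ∧ ∃ k₀ : ℕ, ∀ k : ℕ, k₀ ≤ k → ∀ δ : ℝ, δ < 1 / 2 → ∀ N : ℕ,
      ∃ n : ℕ, N ≤ n ∧ ∃ D : Digraph (Fin n),
        P.IsInstance D ∧ (commGraph D).Connected ∧ P.HasSolution D k ∧
        ∀ I : Finset ℕ, I.card = n → ∀ (A : RandLocalAlg (Option P.Label)) (T : ℕ),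
          A.SolvesOn D I T k 1 δ → c * k ≤ T) := by
  constructor
  -- In `48 * T * ε * k + 64 * ε * k + 12 * T + 56`, the bound `c ≤ 1 / 192` keeps the first term
  -- below `k / 4`, `ε₀ = 1 / 128` the second below `k / 2`, and `c ≤ C / 48` with `C ≤ ε * k` the
  -- third below `k / 4`. The sum stays below `2 * k` as `k ≥ 100`.
  · refine ⟨1 / 128, by norm_num, fun C hC => ⟨min (1 / 192) (C / 48), by positivity, 100,
      fun k hk ε hε hε₀ δ hδ N => ?_⟩⟩
    obtain ⟨D, hinst, hconn, hsol, q, bit, hchain⟩ :=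
      P.hasChain (k := k) (n := N + 4 * k + 10) (by omega) (by omega)
    refine ⟨N + 4 * k + 10, by omega, D, hinst, hconn, hsol, fun I hI A T hA => ?_⟩
    have hk' : (100 : ℝ) ≤ k := by exact_mod_cast hk
    have hk0 : (0 : ℝ) < k := by linarith
    have hε0 : 0 < ε := lt_of_lt_of_le (by positivity) hε
    have hsize := hchain.lt_of_solvesOn hsol I hI A T ⌊ε * k⌋₊ ε δ hε0.le
      (Nat.lt_floor_add_one _) hδ hA
    have hsize' : (2 * k : ℝ) < (4 * (⌊ε * k⌋₊ : ℝ) + 1) * (12 * T + 16) + 40 := by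
      exact_mod_cast hsize
    have hfloor : (⌊ε * k⌋₊ : ℝ) ≤ ε * k := Nat.floor_le (by positivity)
    by_contra! hT
    set c : ℝ := min (1 / 192) (C / 48) with hc
    have hc1 : c ≤ 1 / 192 := min_le_left _ _
    have hc2 : c ≤ C / 48 := min_le_right _ _
    have hCk : C ≤ ε * k := (div_le_iff₀ hk0).1 hε
    have hT0 : (0 : ℝ) ≤ T := Nat.cast_nonneg T
    have hTε : T * ε < c := (lt_div_iff₀ hε0).1 hT
    have hTk : (T : ℝ) * ε * k ≤ 1 / 192 * k :=
      mul_le_mul_of_nonneg_right (hTε.le.trans hc1) hk0.le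
    have hTC : (T : ℝ) ≤ k / 48 := by
      have h1 : (T : ℝ) * ε ≤ ε * k / 48 := by linarith
      have h2 : (T : ℝ) * ε ≤ k / 48 * ε := by linarith
      exact le_of_mul_le_mul_right h2 hε0
    have hεk : ε * k ≤ 1 / 128 * k := mul_le_mul_of_nonneg_right hε₀ hk0.le
    have hmul : (4 * (⌊ε * k⌋₊ : ℝ) + 1) * (12 * T + 16) ≤ (4 * (ε * k) + 1) * (12 * T + 16) :=
      mul_le_mul_of_nonneg_right (by linarith) (by linarith)
    have hexp : (4 * (ε * k) + 1) * (12 * T + 16) =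
        48 * (T * ε * k) + 64 * (ε * k) + 12 * T + 16 := by ring
    linarith
  · refine ⟨1 / 12, by norm_num, 100, fun k hk δ hδ N => ?_⟩
    obtain ⟨D, hinst, hconn, hsol, q, bit, hchain⟩ :=
      P.hasChain (k := k) (n := N + 4 * k + 10) (by omega) (by omega)
    refine ⟨N + 4 * k + 10, by omega, D, hinst, hconn, hsol, fun I hI A T hA => ?_⟩
    -- With `b = 0` there is a single window, and the bound reads `2 * k < 12 * T + 56`.
    have hsize := hchain.lt_of_solvesOn hsol I hI A T 0 0 δ le_rfl (by norm_num) hδ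
      (by rwa [add_zero])
    have hTk : k ≤ 12 * T := by omega
    have : (k : ℝ) ≤ 12 * T := by exact_mod_cast hTk
    linarith
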